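/- Let $m>0$, let $X=X_m^+=\{k\in\mathbb R^4: k\cdot k=m^2,\ k^0>0\}$ with $k\cdot p=k^0p^0-\mathbf k\cdot\mathbf p$, and let $d\alpha(k)=d\mathbf k/(2\omega(\mathbf k))$, $\omega(\mathbf k)=\sqrt{\mathbf k^2+m^2}$. *Spaces.* The auxiliary Bosonic Fock space $\mathcal H$ consists of the sequences $(\Phi^{(n)})_{n\ge0}$ of (classes of) Borel functions $\Phi^{(n)}_{\mu_1\dots\mu_n}(k_1,\dots,k_n)$ on $X^n$, $\mu_i\in\{0,1,2,3\}$, symmetric under simultaneous permutations of the pairs $(\mu_i,k_i)$, with $\sum_n\sum_\mu\int|\Phi^{(n)}_\mu|^2d\alpha^{n}<\infty$. Let $$\mathcal H'=\{\Phi\in\mathcal H:\ k_1^{\nu}\Phi^{(n)}_{\nu\mu_2\dots\mu_n}(k_1,\dots,k_n)=0\ \text{a.e., for all } n\ge1\}.$$ The space $\mathcal H^{gh}$ consists of the families of (classes of) Borel functions $\Phi^{(nwls)}_{\mu_1\dots\mu_n}(K;P;Q;R)$, $n,w,l,s\ge0$, of $K=(k_1,\dots,k_n)$, $P=(p_1,\dots,p_w)$,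 $Q=(q_1,\dots,q_l)$, $R=(r_1,\dots,r_s)$ with entries in $X$, which are symmetric in the pairs $(\mu_i,k_i)$, antisymmetric in $P$, antisymmetric in $Q$, symmetric in $R$, and satisfy $\sum_{nwls}\sum_\mu\int|\Phi^{(nwls)}_\mu|^2<\infty$. Let $\iota:\mathcal H\to\mathcal H^{gh}$ be the embedding $(\iota\Phi)^{(n000)}=\Phi^{(n)}$, $(\iota\Phi)^{(nwls)}=0$ for $w+l+s>0$. *Supercharge.* With $k_\mu=g_{\mu\nu}k^\nu$, a hat denoting omission, and empty sums equal to $0$, $$\begin{aligned}(Q\Phi)^{(nwls)}_{\mu_1\dots\mu_n}(K;P;Q;R)={}&(-1)^w\sqrt{\tfrac{n+1}{l}}\sum_{i=1}^l(-1)^{i-1}q_i^\nu\,\Phi^{(n+1,w,l-1,s)}_{\nu\mu_1\dots\mu_n}(q_i,K;P;q_1,\dots,\hat q_i,\dots,q_l;R)\\&-\sqrt{\tfrac{w+1}{n}}\sum_{i=1}^n(k_i)_{\mu_i}\Phi^{(n-1,w+1,l,s)}_{\mu_1\dots\hat\mu_i\dots\mu_n}(k_1,\dots,\hat k_i,\dots,k_n;k_i,P;Q;R)\\&+im(-1)^w\sqrt{\tfrac{s+1}{l}}\sum_{i=1}^l(-1)^{i-1}\Phi^{(n,w,l-1,s+1)}_{\mu_1\dots\mu_n}(K;P;q_1,\dots,\hat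 q_i,\dots,q_l;q_i,R)\\&-im\sqrt{\tfrac{w+1}{s}}\sum_{i=1}^s\Phi^{(n,w+1,l,s-1)}_{\mu_1\dots\mu_n}(K;r_i,P;Q;r_1,\dots,\hat r_i,\dots,r_s).\end{aligned}$$ Let $\mathcal D_{0}\subset\mathcal H^{gh}$ be the space of the $\Phi$ with only finitely many nonzero components $\Phi^{(nwls)}$, each of which remains square integrable when the longitudinal projector $(P\psi)_\mu(k)=m^{-2}k_\mu k^\nu\psi_\nu(k)$ is applied in any set of the vector variables $(\mu_i,k_i)$. Put $\mathcal D=\mathcal D_0+\iota(\mathcal H')$ and let $Q$ have the domain $D(Q)=\{\Phi\in\mathcal D: Q\Phi\in\mathcal D\}$. Let $\mathrm{Ker}(Q)=\{\Phi\in D(Q):Q\Phi=0\}$ and $\mathrm{Im}(Q)=Q(D(Q))$. *Proposition.* $\mathrm{Im}(Q)\subset\mathrm{Ker}(Q)$, $\iota(\mathcal H')\subset\mathrm{Ker}(Q)$, and there is a vector-space isomorphism $$\mathrm{Ker}(Q)/\mathrm{Im}(Q)\;\cong\;\mathcal H'$$ which sends the class of $\iota\Phi$ to $\Phi$ for every $\Phi\in\mathcal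 H'$. -/

import Mathlib

open MeasureTheory

noncomputable section

namespace SpinOneBoson

/-! ### The mass shell -/

/-- The Minkowski bilinear form on `ℝ⁴`, signature `(+,-,-,-)`. -/
def minkowski (p q : Fin 4 → ℝ) : ℝ := p 0 * q 0 - ∑ i : Fin 3, p i.succ * q i.succ

/-- The upper hyperboloid of mass `m`. -/
abbrev Shell (m : ℝ) : Type := {p : Fin 4 → ℝ // minkowski p p = m ^ 2 ∧ 0 < p 0}

/-- The energy `ω(𝐩)`. -/
def omega (m : ℝ) (p : Fin 3 → ℝ) : ℝ := √(∑ i, p i ^ 2 + m ^ 2)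

/-- The projection `(p⁰, 𝐩) ↦ 𝐩`, injective on the hyperboloid. -/
def spatial (m : ℝ) (k : Shell m) : Fin 3 → ℝ := fun i => k.1 i.succ

/-- The Lorentz invariant measure `d𝐩 / 2ω(𝐩)` on the hyperboloid. -/
def shellMeasure (m : ℝ) : Measure (Shell m) :=
  ((volume : Measure (Fin 3 → ℝ)).withDensity
    fun p => ENNReal.ofReal (1 / (2 * omega m p))).comap (spatial m)

/-- Contravariant component `k^μ`. -/
def upper {m : ℝ} (k : Shell m) (μ : Fin 4) : ℂ := ((k.1 μ : ℝ) : ℂ)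

/-- Covariant component `k_μ = g_{μν} k^ν`. -/
def lower {m : ℝ} (k : Shell m) (μ : Fin 4) : ℂ := if μ = 0 then upper k μ else -upper k μ

theorem measurable_spatial (m : ℝ) : Measurable (spatial m) :=
  measurable_pi_lambda _ fun i => (measurable_pi_apply i.succ).comp measurable_subtype_coe

theorem spatial_injective (m : ℝ) : Function.Injective (spatial m) := by
  rintro ⟨p, hp, hp0⟩ ⟨q, hq, hq0⟩ h
  have hs : ∀ i : Fin 3, p i.succ = q i.succ := fun i => congrFun h i
  have h0 : p 0 = q 0 := by
    simp only [minkowski, hs] at hp hq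
    nlinarith
  apply Subtype.ext
  funext i
  refine Fin.cases h0 hs i

theorem measurableSet_shell (m : ℝ) :
    MeasurableSet {p : Fin 4 → ℝ | minkowski p p = m ^ 2 ∧ 0 < p 0} := by
  apply MeasurableSet.inter
  · exact measurableSet_eq_fun (by unfold minkowski; fun_prop) measurable_const
  · exact measurableSet_lt measurable_const (measurable_pi_apply 0)

theorem measurableEmbedding_spatial (m : ℝ) : MeasurableEmbedding (spatial m) := by
  have : StandardBorelSpace (Shell m) := (measurableSet_shell m).standardBorel
  exact (measurable_spatial m).measurableEmbedding (spatial_injective m)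

instance (m : ℝ) : SigmaFinite (shellMeasure m) := by
  apply SigmaFinite.of_map _ (measurable_spatial m).aemeasurable
  rw [shellMeasure, (measurableEmbedding_spatial m).map_comap]
  infer_instance

/-! ### Wave functions -/

/-- Configurations `(K; P; Q; R)` of `n` vector Bosons, `w` and `l` Fermionic ghosts and
`s` Bosonic ghosts. -/
abbrev Conf (m : ℝ) (n w l s : ℕ) : Type :=
  (Fin n → Shell m) × (Fin w → Shell m) × (Fin l → Shell m) × (Fin s → Shell m)

/-- The `n`-fold product of the invariant measure. -/
abbrev prodMeasure (m : ℝ) (n : ℕ) : Measure (Fin n → Shell m) :=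
  Measure.pi fun _ => shellMeasure m

/-- The product measure on configurations. -/
abbrev confMeasure (m : ℝ) (n w l s : ℕ) : Measure (Conf m n w l s) :=
  (prodMeasure m n).prod ((prodMeasure m w).prod ((prodMeasure m l).prod (prodMeasure m s)))

/-- Families `Φ^{(nwls)}_{μ₁…μₙ}(K; P; Q; R)` of complex functions. -/
abbrev Family (m : ℝ) : Type :=
  ∀ n w l s : ℕ, (Fin n → Fin 4) → Conf m n w l s → ℂ

/-- Families of Borel functions. -/
def borel (m : ℝ) : Submodule ℂ (Family m) where
  carrier := {Φ | ∀ n w l s μ, Measurable (Φ n w l s μ)}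
  zero_mem' := fun _ _ _ _ _ => measurable_const
  add_mem' := fun ha hb n w l s μ => (ha n w l s μ).add (hb n w l s μ)
  smul_mem' := fun c _ ha n w l s μ => (ha n w l s μ).const_smul c

/-- Families of Borel functions that vanish almost everywhere. -/
def null (m : ℝ) : Submodule ℂ (borel m) where
  carrier := {Φ | ∀ n w l s μ, Φ.1 n w l s μ =ᵐ[confMeasure m n w l s] 0}
  zero_mem' := fun _ _ _ _ _ => Filter.EventuallyEq.rfl
  add_mem' := fun {a b} ha hb n w l s μ => by
    filter_upwards [ha n w l s μ, hb n w l s μ] with x hx hy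
    simp [hx, hy]
  smul_mem' := fun c a ha n w l s μ => by
    filter_upwards [ha n w l s μ] with x hx
    simp [hx]

/-- Classes of families of Borel functions modulo equality almost everywhere. -/
abbrev Wave (m : ℝ) : Type := borel m ⧸ null m

/-- Symmetry in the Bosonic variables, antisymmetry in each kind of Fermionic variables. -/
def IsSymm {m : ℝ} (Φ : Family m) : Prop :=
  ∀ (n w l s : ℕ) (π : Equiv.Perm (Fin n)) (σ : Equiv.Perm (Fin w)) (τ : Equiv.Perm (Fin l))
    (θ : Equiv.Perm (Fin s)) (μ : Fin n → Fin 4) (x : Conf m n w l s),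
    Φ n w l s (μ ∘ π) (x.1 ∘ π, x.2.1 ∘ σ, x.2.2.1 ∘ τ, x.2.2.2 ∘ θ) =
      ((Equiv.Perm.sign σ : ℤ) : ℂ) * ((Equiv.Perm.sign τ : ℤ) : ℂ) * Φ n w l s μ x

theorem lintegral_sq_add_le {α : Type*} [MeasurableSpace α] (ν : Measure α) {f g : α → ℂ}
    (hf : Measurable f) :
    ∫⁻ x, ‖f x + g x‖ₑ ^ 2 ∂ν ≤ 2 * ∫⁻ x, ‖f x‖ₑ ^ 2 ∂ν + 2 * ∫⁻ x, ‖g x‖ₑ ^ 2 ∂ν := by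
  have key : ∀ a b : ℂ, ‖a + b‖ₑ ^ 2 ≤ 2 * ‖a‖ₑ ^ 2 + 2 * ‖b‖ₑ ^ 2 := by
    intro a b
    simp only [← ofReal_norm]
    rw [← ENNReal.ofReal_pow (norm_nonneg _), ← ENNReal.ofReal_pow (norm_nonneg _),
      ← ENNReal.ofReal_pow (norm_nonneg _), ← ENNReal.ofReal_ofNat 2,
      ← ENNReal.ofReal_mul (by norm_num), ← ENNReal.ofReal_mul (by norm_num),
      ← ENNReal.ofReal_add (by positivity) (by positivity)]
    apply ENNReal.ofReal_le_ofReal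
    have := norm_add_le a b
    nlinarith [norm_nonneg (a + b), norm_nonneg a, norm_nonneg b, sq_nonneg (‖a‖ - ‖b‖)]
  calc ∫⁻ x, ‖f x + g x‖ₑ ^ 2 ∂ν ≤ ∫⁻ x, (2 * ‖f x‖ₑ ^ 2 + 2 * ‖g x‖ₑ ^ 2) ∂ν :=
        lintegral_mono fun x => key _ _
    _ = _ := by
        rw [lintegral_add_left ((hf.enorm.pow_const 2).const_mul 2),
          lintegral_const_mul' _ _ (by norm_num), lintegral_const_mul' _ _ (by norm_num)]

theorem lintegral_sq_smul {α : Type*} [MeasurableSpace α] (ν : Measure α) (c : ℂ) (f : α → ℂ) :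
    ∫⁻ x, ‖c * f x‖ₑ ^ 2 ∂ν = ‖c‖ₑ ^ 2 * ∫⁻ x, ‖f x‖ₑ ^ 2 ∂ν := by
  simp only [enorm_mul, mul_pow]
  exact lintegral_const_mul' _ _ (by simp)

/-- The squared norm of a family of functions. -/
def normSq {m : ℝ} (Φ : Family m) : ENNReal :=
  ∑' (n : ℕ) (w : ℕ) (l : ℕ) (s : ℕ), ∑ μ : Fin n → Fin 4,
    ∫⁻ x, ‖Φ n w l s μ x‖ₑ ^ 2 ∂confMeasure m n w l s

theorem normSq_add_le {m : ℝ} {Φ Ψ : Family m} (hΦ : Φ ∈ borel m) :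
    normSq (Φ + Ψ) ≤ 2 * normSq Φ + 2 * normSq Ψ := by
  simp only [normSq, ← ENNReal.tsum_mul_left, Finset.mul_sum, ← ENNReal.tsum_add,
    ← Finset.sum_add_distrib]
  gcongr
  exact lintegral_sq_add_le _ (hΦ _ _ _ _ _)

theorem normSq_smul {m : ℝ} (c : ℂ) (Φ : Family m) : normSq (c • Φ) = ‖c‖ₑ ^ 2 * normSq Φ := by
  simp only [normSq, ← ENNReal.tsum_mul_left, Finset.mul_sum]
  simp only [Pi.smul_apply, smul_eq_mul, lintegral_sq_smul]

/-- Symmetric families of Borel functions of finite norm. -/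
def ghostFamilies (m : ℝ) : Submodule ℂ (borel m) where
  carrier := {Φ | IsSymm Φ.1 ∧ normSq Φ.1 < ⊤}
  zero_mem' := ⟨fun _ _ _ _ _ _ _ _ _ _ => by simp, by simp [normSq]⟩
  add_mem' := fun {a b} ha hb =>
    ⟨fun n w l s π σ τ θ μ x => by
      have h1 := ha.1 n w l s π σ τ θ μ x
      have h2 := hb.1 n w l s π σ τ θ μ x
      simp only [Submodule.coe_add, Pi.add_apply, h1, h2, mul_add],
    (normSq_add_le a.2).trans_lt (ENNReal.add_lt_top.2
      ⟨ENNReal.mul_lt_top (by norm_num) ha.2, ENNReal.mul_lt_top (by norm_num) hb.2⟩)⟩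
  smul_mem' := fun c a ha =>
    ⟨fun n w l s π σ τ θ μ x => by
      have h1 := ha.1 n w l s π σ τ θ μ x
      simp only [Submodule.coe_smul, Pi.smul_apply, h1, smul_eq_mul]
      ring,
    by
      have : normSq (c • a.1) < ⊤ := by
        rw [normSq_smul]
        exact ENNReal.mul_lt_top (by simp) ha.2
      exact this⟩

/-- The Hilbert space `𝓗^{gh}` (its underlying vector space). -/
def ghostFock (m : ℝ) : Submodule ℂ (Wave m) := (ghostFamilies m).map (null m).mkQ

/-! ### The auxiliary Bosonic Fock space and its transversal subspace -/

/-- Families `Φ^{(n)}_{μ₁…μₙ}(k₁,…,kₙ)` of complex functions. -/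
abbrev BoseFamily (m : ℝ) : Type :=
  ∀ n : ℕ, (Fin n → Fin 4) → (Fin n → Shell m) → ℂ

/-- Families of Borel functions. -/
def boseBorel (m : ℝ) : Submodule ℂ (BoseFamily m) where
  carrier := {Φ | ∀ n μ, Measurable (Φ n μ)}
  zero_mem' := fun _ _ => measurable_const
  add_mem' := fun ha hb n μ => (ha n μ).add (hb n μ)
  smul_mem' := fun c _ ha n μ => (ha n μ).const_smul c

/-- Families of Borel functions that vanish almost everywhere. -/
def boseNull (m : ℝ) : Submodule ℂ (boseBorel m) where
  carrier := {Φ | ∀ n μ, Φ.1 n μ =ᵐ[prodMeasure m n] 0}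
  zero_mem' := fun _ _ => Filter.EventuallyEq.rfl
  add_mem' := fun {a b} ha hb n μ => by
    filter_upwards [ha n μ, hb n μ] with x hx hy
    simp [hx, hy]
  smul_mem' := fun c a ha n μ => by
    filter_upwards [ha n μ] with x hx
    simp [hx]

/-- Classes of families of Borel functions modulo equality almost everywhere. -/
abbrev BoseWave (m : ℝ) : Type := boseBorel m ⧸ boseNull m

/-- The squared norm in the auxiliary Bosonic Fock space. -/
def boseNormSq {m : ℝ} (Φ : BoseFamily m) : ENNReal :=
  ∑' n : ℕ, ∑ μ : Fin n → Fin 4, ∫⁻ x, ‖Φ n μ x‖ₑ ^ 2 ∂prodMeasure m n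

/-- Symmetric families of Borel functions of finite norm. -/
def boseFamilies (m : ℝ) : Submodule ℂ (boseBorel m) where
  carrier := {Φ | (∀ (n : ℕ) (π : Equiv.Perm (Fin n)) (μ : Fin n → Fin 4) (K : Fin n → Shell m),
    Φ.1 n (μ ∘ π) (K ∘ π) = Φ.1 n μ K) ∧ boseNormSq Φ.1 < ⊤}
  zero_mem' := ⟨fun _ _ _ _ => rfl, by simp [boseNormSq]⟩
  add_mem' := fun {a b} ha hb =>
    ⟨fun n π μ K => by
      simp only [Submodule.coe_add, Pi.add_apply, ha.1 n π μ K, hb.1 n π μ K],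
    by
      have h : boseNormSq (a.1 + b.1) ≤ 2 * boseNormSq a.1 + 2 * boseNormSq b.1 := by
        simp only [boseNormSq, ← ENNReal.tsum_mul_left, Finset.mul_sum, ← ENNReal.tsum_add,
          ← Finset.sum_add_distrib]
        gcongr
        exact lintegral_sq_add_le _ (a.2 _ _)
      exact h.trans_lt (ENNReal.add_lt_top.2
        ⟨ENNReal.mul_lt_top (by norm_num) ha.2, ENNReal.mul_lt_top (by norm_num) hb.2⟩)⟩
  smul_mem' := fun c a ha =>
    ⟨fun n π μ K => by
      simp only [Submodule.coe_smul, Pi.smul_apply, ha.1 n π μ K],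
    by
      have h : boseNormSq (c • a.1) = ‖c‖ₑ ^ 2 * boseNormSq a.1 := by
        simp only [boseNormSq, ← ENNReal.tsum_mul_left, Finset.mul_sum]
        simp only [Pi.smul_apply, smul_eq_mul, lintegral_sq_smul]
      have h' : boseNormSq (c • a.1) < ⊤ := by
        rw [h]
        exact ENNReal.mul_lt_top (by simp) ha.2
      exact h'⟩

/-- The auxiliary Bosonic Fock space `𝓗`. -/
def boseFock (m : ℝ) : Submodule ℂ (BoseWave m) := (boseFamilies m).map (boseNull m).mkQ

/-- Families with `k₁^ν Φ^{(n)}_{ν μ₂ … μₙ}(k₁,…,kₙ) = 0` almost everywhere, for all `n ≥ 1`. -/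
def transversalFamilies (m : ℝ) : Submodule ℂ (boseBorel m) where
  carrier := {Φ | ∀ (n : ℕ) (μ : Fin n → Fin 4), ∀ᵐ K ∂prodMeasure m (n + 1),
    ∑ ν : Fin 4, upper (K 0) ν * Φ.1 (n + 1) (Matrix.vecCons ν μ) K = 0}
  zero_mem' := fun _ _ => by simp
  add_mem' := fun {a b} ha hb n μ => by
    filter_upwards [ha n μ, hb n μ] with K h1 h2
    simp only [Submodule.coe_add, Pi.add_apply, mul_add, Finset.sum_add_distrib, h1, h2, add_zero]
  smul_mem' := fun c a ha n μ => by
    filter_upwards [ha n μ] with K h1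
    simp only [Submodule.coe_smul, Pi.smul_apply, smul_eq_mul, mul_left_comm _ c,
      ← Finset.mul_sum, h1, mul_zero]

/-- The subspace `𝓗'` of transversal states of the auxiliary Bosonic Fock space. -/
def physical (m : ℝ) : Submodule ℂ (BoseWave m) :=
  (boseFamilies m ⊓ transversalFamilies m).map (boseNull m).mkQ

/-- A Bosonic state as a state without ghosts: `Φ^{(n000)} = Φ^{(n)}`, and `Φ^{(nwls)} = 0` for
`w + l + s > 0`. -/
def embedFamily (m : ℝ) : boseBorel m →ₗ[ℂ] borel m where
  toFun Φ := ⟨fun n w l s μ x => if w + l + s = 0 then Φ.1 n μ x.1 else 0, fun n w l s μ => by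
    by_cases h : w + l + s = 0
    · simp only [h, if_true]
      exact (Φ.2 n μ).comp measurable_fst
    · simp only [h, if_false]
      exact measurable_const⟩
  map_add' a b := by
    ext n w l s μ x
    by_cases h : w + l + s = 0 <;>
      simp only [h, if_true, if_false, Submodule.coe_add, Pi.add_apply, add_zero]
  map_smul' c a := by
    ext n w l s μ x
    by_cases h : w + l + s = 0 <;>
      simp only [h, if_true, if_false, Submodule.coe_smul, Pi.smul_apply, smul_zero,
        RingHom.id_apply]

theorem embedFamily_null (m : ℝ) : boseNull m ≤ (null m).comap (embedFamily m) := by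
  intro Φ hΦ n w l s μ
  by_cases h : w + l + s = 0
  · have := Measure.quasiMeasurePreserving_fst (μ := prodMeasure m n)
      (ν := (prodMeasure m w).prod ((prodMeasure m l).prod (prodMeasure m s))) |>.ae_eq_comp
        (hΦ n μ)
    filter_upwards [this] with x hx
    simp only [embedFamily, LinearMap.coe_mk, AddHom.coe_mk, h, if_true]
    exact hx
  · filter_upwards with x
    simp only [embedFamily, LinearMap.coe_mk, AddHom.coe_mk, h, if_false]
    rfl

/-- The embedding of Bosonic states as ghost-free states. -/
def embed (m : ℝ) : BoseWave m →ₗ[ℂ] Wave m :=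
  (boseNull m).mapQ (null m) (embedFamily m) (embedFamily_null m)

theorem physical_le_boseFock (m : ℝ) : physical m ≤ boseFock m :=
  Submodule.map_mono inf_le_left

theorem normSq_embedFamily {m : ℝ} (Φ : boseBorel m) :
    normSq (embedFamily m Φ).1 = boseNormSq Φ.1 := by
  unfold normSq boseNormSq
  congr 1
  funext n
  rw [tsum_eq_single 0, tsum_eq_single 0, tsum_eq_single 0]
  · refine Finset.sum_congr rfl fun μ _ => ?_
    have h0 : IsProbabilityMeasure (prodMeasure m 0) := by
      unfold prodMeasure
      rw [Measure.pi_of_empty]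
      infer_instance
    have h : MeasurePreserving (Prod.fst : Conf m n 0 0 0 → _) (confMeasure m n 0 0 0)
        (prodMeasure m n) := measurePreserving_fst
    exact h.lintegral_comp ((Φ.2 n μ).enorm.pow_const 2)
  · intro s hs
    simp [embedFamily, hs]
  · intro l hl
    simp [embedFamily, hl]
  · intro w hw
    simp [embedFamily, hw]

theorem embed_mem_ghostFock {m : ℝ} {φ : BoseWave m} (hφ : φ ∈ boseFock m) :
    embed m φ ∈ ghostFock m := by
  obtain ⟨Φ, ⟨h1, h2⟩, rfl⟩ := hφ
  refine ⟨embedFamily m Φ, ⟨?_, by rwa [normSq_embedFamily]⟩, rfl⟩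
  intro n w l s π σ τ θ μ x
  by_cases h : w + l + s = 0
  · obtain ⟨rfl, rfl, rfl⟩ : w = 0 ∧ l = 0 ∧ s = 0 := by omega
    have hσ : σ = 1 := Subsingleton.elim _ _
    have hτ : τ = 1 := Subsingleton.elim _ _
    subst hσ hτ
    simpa [embedFamily] using h1 n π μ x.1
  · simp only [embedFamily, LinearMap.coe_mk, AddHom.coe_mk, h, if_false, mul_zero]

/-! ### The supercharge -/

/-- `∫ dα k^μ A_μ(k) c^*(k)`. -/
def chargeVectorC {m : ℝ} (Φ : Family m) : Family m
  | _, _, 0, _ => fun _ _ => 0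
  | n, w, l + 1, s => fun μ x =>
    (-1) ^ w * (√((n + 1 : ℝ) / (l + 1 : ℝ)) : ℂ) * ∑ i : Fin (l + 1), (-1) ^ (i : ℕ) *
      ∑ ν : Fin 4, upper (x.2.2.1 i) ν * Φ (n + 1) w l s (Matrix.vecCons ν μ)
        (Matrix.vecCons (x.2.2.1 i) x.1, x.2.1, x.2.2.1 ∘ i.succAbove, x.2.2.2)

/-- `∫ dα k^μ A†_μ(k) b(k)`. -/
def chargeVectorB {m : ℝ} (Φ : Family m) : Family m
  | 0, _, _, _ => fun _ _ => 0
  | n + 1, w, l, s => fun μ x =>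
    -(√((w + 1 : ℝ) / (n + 1 : ℝ)) : ℂ) * ∑ i : Fin (n + 1), lower (x.1 i) (μ i) *
      Φ n (w + 1) l s (μ ∘ i.succAbove)
        (x.1 ∘ i.succAbove, Matrix.vecCons (x.1 i) x.2.1, x.2.2.1, x.2.2.2)

/-- `im ∫ dα a(k) c^*(k)`. -/
def chargeScalarC {m : ℝ} (Φ : Family m) : Family m
  | _, _, 0, _ => fun _ _ => 0
  | n, w, l + 1, s => fun μ x =>
    Complex.I * m * (-1) ^ w * (√((s + 1 : ℝ) / (l + 1 : ℝ)) : ℂ) *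
      ∑ i : Fin (l + 1), (-1) ^ (i : ℕ) * Φ n w l (s + 1) μ
        (x.1, x.2.1, x.2.2.1 ∘ i.succAbove, Matrix.vecCons (x.2.2.1 i) x.2.2.2)

/-- `-im ∫ dα a^*(k) b(k)`. -/
def chargeScalarB {m : ℝ} (Φ : Family m) : Family m
  | _, _, _, 0 => fun _ _ => 0
  | n, w, l, s + 1 => fun μ x =>
    -(Complex.I * m) * (√((w + 1 : ℝ) / (s + 1 : ℝ)) : ℂ) *
      ∑ i : Fin (s + 1), Φ n (w + 1) l s μ
        (x.1, Matrix.vecCons (x.2.2.2 i) x.2.1, x.2.2.1, x.2.2.2 ∘ i.succAbove)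

/-- The supercharge `Q` on families of functions. -/
def chargeFamily {m : ℝ} (Φ : Family m) : Family m :=
  chargeVectorC Φ + chargeVectorB Φ + chargeScalarC Φ + chargeScalarB Φ

section MeasurePreservingMaps

variable {α β γ : Type*} [MeasurableSpace α] [MeasurableSpace β] [MeasurableSpace γ]

theorem measurePreserving_swapLeft (a : Measure α) (b : Measure β) (c : Measure γ)
    [SigmaFinite a] [SigmaFinite b] [SigmaFinite c] :
    MeasurePreserving (fun x : α × β × γ => (x.2.1, x.1, x.2.2))
      (a.prod (b.prod c)) (b.prod (a.prod c)) :=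
  ((measurePreserving_prodAssoc b a c).comp
    ((Measure.measurePreserving_swap (μ := a) (ν := b)).prod (MeasurePreserving.id c))).comp
    (measurePreserving_prodAssoc a b c).symm

/-- Moving the `i`-th variable of the first kind to the front of the second kind. -/
theorem measurePreserving_transfer (m : ℝ) (a b : ℕ) (i : Fin (a + 1)) :
    MeasurePreserving
      (fun x : (Fin (a + 1) → Shell m) × (Fin b → Shell m) =>
        ((x.1 ∘ i.succAbove, Matrix.vecCons (x.1 i) x.2) :
          (Fin a → Shell m) × (Fin (b + 1) → Shell m)))
      ((prodMeasure m (a + 1)).prod (prodMeasure m b))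
      ((prodMeasure m a).prod (prodMeasure m (b + 1))) := by
  have h1 := measurePreserving_piFinSuccAbove (fun _ : Fin (a + 1) => shellMeasure m) i
  have h2 := (measurePreserving_piFinSuccAbove (fun _ : Fin (b + 1) => shellMeasure m) 0).symm
  have h3 := ((((MeasurePreserving.id (prodMeasure m a)).prod h2).comp
    (measurePreserving_prodAssoc (prodMeasure m a) (shellMeasure m) (prodMeasure m b))).comp
    ((Measure.measurePreserving_swap (μ := shellMeasure m) (ν := prodMeasure m a)).prod
      (MeasurePreserving.id (prodMeasure m b)))).comp
    (h1.prod (MeasurePreserving.id (prodMeasure m b)))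
  convert h3 using 1
  funext x
  refine Prod.ext rfl ?_
  exact (Fin.insertNth_zero (α := fun _ => Shell m) (x.1 i) x.2).symm

theorem measurePreserving_vectorC (m : ℝ) (n w l s : ℕ) (i : Fin (l + 1)) :
    MeasurePreserving
      (fun x : Conf m n w (l + 1) s =>
        ((Matrix.vecCons (x.2.2.1 i) x.1, x.2.1, x.2.2.1 ∘ i.succAbove, x.2.2.2) :
          Conf m (n + 1) w l s))
      (confMeasure m n w (l + 1) s) (confMeasure m (n + 1) w l s) := by
  have h := (Measure.measurePreserving_swap (μ := prodMeasure m l)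
    (ν := prodMeasure m (n + 1))).comp ((measurePreserving_transfer m l n i).comp
      (Measure.measurePreserving_swap (μ := prodMeasure m n) (ν := prodMeasure m (l + 1))))
  have h' := ((measurePreserving_prodAssoc _ _ _).comp
    (h.prod (MeasurePreserving.id (prodMeasure m s)))).comp
    (measurePreserving_prodAssoc _ _ _).symm
  exact (measurePreserving_swapLeft _ _ _).comp
    (((MeasurePreserving.id (prodMeasure m w)).prod h').comp (measurePreserving_swapLeft _ _ _))

theorem measurePreserving_vectorB (m : ℝ) (n w l s : ℕ) (i : Fin (n + 1)) :
    MeasurePreserving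
      (fun x : Conf m (n + 1) w l s =>
        ((x.1 ∘ i.succAbove, Matrix.vecCons (x.1 i) x.2.1, x.2.2.1, x.2.2.2) :
          Conf m n (w + 1) l s))
      (confMeasure m (n + 1) w l s) (confMeasure m n (w + 1) l s) :=
  ((measurePreserving_prodAssoc _ _ _).comp
    ((measurePreserving_transfer m n w i).prod (MeasurePreserving.id _))).comp
    (measurePreserving_prodAssoc _ _ _).symm

theorem measurePreserving_scalarC (m : ℝ) (n w l s : ℕ) (i : Fin (l + 1)) :
    MeasurePreserving
      (fun x : Conf m n w (l + 1) s =>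
        ((x.1, x.2.1, x.2.2.1 ∘ i.succAbove, Matrix.vecCons (x.2.2.1 i) x.2.2.2) :
          Conf m n w l (s + 1)))
      (confMeasure m n w (l + 1) s) (confMeasure m n w l (s + 1)) :=
  (MeasurePreserving.id _).prod
    ((MeasurePreserving.id _).prod (measurePreserving_transfer m l s i))

theorem measurePreserving_scalarB (m : ℝ) (n w l s : ℕ) (i : Fin (s + 1)) :
    MeasurePreserving
      (fun x : Conf m n w l (s + 1) =>
        ((x.1, Matrix.vecCons (x.2.2.2 i) x.2.1, x.2.2.1, x.2.2.2 ∘ i.succAbove) :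
          Conf m n (w + 1) l s))
      (confMeasure m n w l (s + 1)) (confMeasure m n (w + 1) l s) := by
  have h := (Measure.measurePreserving_swap (μ := prodMeasure m s)
    (ν := prodMeasure m (w + 1))).comp ((measurePreserving_transfer m s w i).comp
      (Measure.measurePreserving_swap (μ := prodMeasure m w) (ν := prodMeasure m (s + 1))))
  exact (MeasurePreserving.id (prodMeasure m n)).prod
    ((measurePreserving_swapLeft _ _ _).comp
      (((MeasurePreserving.id (prodMeasure m l)).prod h).comp (measurePreserving_swapLeft _ _ _)))

end MeasurePreservingMaps

theorem measurable_upper {m : ℝ} (μ : Fin 4) : Measurable fun k : Shell m => upper k μ :=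
  Complex.measurable_ofReal.comp ((measurable_pi_apply μ).comp measurable_subtype_coe)

theorem measurable_lower {m : ℝ} (μ : Fin 4) : Measurable fun k : Shell m => lower k μ := by
  unfold lower
  split_ifs
  · exact measurable_upper μ
  · exact (measurable_upper μ).neg

theorem chargeFamily_borel {m : ℝ} {Φ : Family m} (hΦ : Φ ∈ borel m) :
    chargeFamily Φ ∈ borel m := by
  refine Submodule.add_mem _ (Submodule.add_mem _ (Submodule.add_mem _ ?_ ?_) ?_) ?_
  · rintro n w (_ | l) s μ
    · exact measurable_const
    · refine Measurable.const_mul (Finset.measurable_fun_sum _ fun i _ =>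
        Measurable.const_mul (Finset.measurable_fun_sum _ fun ν _ => ?_) _) _
      exact ((measurable_upper ν).comp (by fun_prop)).mul
        ((hΦ _ _ _ _ _).comp (measurePreserving_vectorC m n w l s i).measurable)
  · rintro (_ | n) w l s μ
    · exact measurable_const
    · refine Measurable.const_mul (Finset.measurable_fun_sum _ fun i _ => ?_) _
      exact ((measurable_lower (μ i)).comp (by fun_prop)).mul
        ((hΦ _ _ _ _ _).comp (measurePreserving_vectorB m n w l s i).measurable)
  · rintro n w (_ | l) s μ
    · exact measurable_const
    · refine Measurable.const_mul (Finset.measurable_fun_sum _ fun i _ =>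
        Measurable.const_mul ?_ _) _
      exact (hΦ _ _ _ _ _).comp (measurePreserving_scalarC m n w l s i).measurable
  · rintro n w l (_ | s) μ
    · exact measurable_const
    · refine Measurable.const_mul (Finset.measurable_fun_sum _ fun i _ => ?_) _
      exact (hΦ _ _ _ _ _).comp (measurePreserving_scalarB m n w l s i).measurable

/-- The supercharge on families of Borel functions. -/
def chargeBorel (m : ℝ) : borel m →ₗ[ℂ] borel m where
  toFun Φ := ⟨chargeFamily Φ.1, chargeFamily_borel Φ.2⟩
  map_add' a b := by
    apply Subtype.ext
    funext n w l s μ x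
    rcases n with _ | n <;> rcases l with _ | l <;> rcases s with _ | s <;>
    · simp only [chargeFamily, chargeVectorC, chargeVectorB, chargeScalarC, chargeScalarB,
        Submodule.coe_add, Pi.add_apply, mul_add, Finset.sum_add_distrib]
      ring
  map_smul' c a := by
    apply Subtype.ext
    funext n w l s μ x
    rcases n with _ | n <;> rcases l with _ | l <;> rcases s with _ | s <;>
    · simp only [chargeFamily, chargeVectorC, chargeVectorB, chargeScalarC, chargeScalarB,
        Submodule.coe_smul, Pi.smul_apply, Pi.add_apply, smul_eq_mul, RingHom.id_apply, mul_add,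
        mul_left_comm _ c, ← Finset.mul_sum, mul_zero]

theorem chargeBorel_null (m : ℝ) : null m ≤ (null m).comap (chargeBorel m) := by
  intro Φ hΦ
  have h : ∀ n w l s μ,
      chargeVectorC Φ.1 n w l s μ =ᵐ[confMeasure m n w l s] 0 ∧
      chargeVectorB Φ.1 n w l s μ =ᵐ[confMeasure m n w l s] 0 ∧
      chargeScalarC Φ.1 n w l s μ =ᵐ[confMeasure m n w l s] 0 ∧
      chargeScalarB Φ.1 n w l s μ =ᵐ[confMeasure m n w l s] 0 := by
    intro n w l s μ
    refine ⟨?_, ?_, ?_, ?_⟩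
    · rcases l with _ | l
      · exact Filter.EventuallyEq.rfl
      · have : ∀ i : Fin (l + 1), ∀ ν : Fin 4, _ := fun i ν =>
          (measurePreserving_vectorC m n w l s i).quasiMeasurePreserving.ae_eq_comp
            (hΦ (n + 1) w l s (Matrix.vecCons ν μ))
        filter_upwards [ae_all_iff.2 fun i => ae_all_iff.2 (this i)] with x hx
        simp only [Function.comp_def, Pi.zero_apply] at hx
        simp [chargeVectorC, Function.comp_def, hx]
    · rcases n with _ | n
      · exact Filter.EventuallyEq.rfl
      · have : ∀ i : Fin (n + 1), _ := fun i =>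
          (measurePreserving_vectorB m n w l s i).quasiMeasurePreserving.ae_eq_comp
            (hΦ n (w + 1) l s (μ ∘ i.succAbove))
        filter_upwards [ae_all_iff.2 this] with x hx
        simp only [Function.comp_def, Pi.zero_apply] at hx
        simp [chargeVectorB, Function.comp_def, hx]
    · rcases l with _ | l
      · exact Filter.EventuallyEq.rfl
      · have : ∀ i : Fin (l + 1), _ := fun i =>
          (measurePreserving_scalarC m n w l s i).quasiMeasurePreserving.ae_eq_comp
            (hΦ n w l (s + 1) μ)
        filter_upwards [ae_all_iff.2 this] with x hx
        simp only [Function.comp_def, Pi.zero_apply] at hx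
        simp [chargeScalarC, Function.comp_def, hx]
    · rcases s with _ | s
      · exact Filter.EventuallyEq.rfl
      · have : ∀ i : Fin (s + 1), _ := fun i =>
          (measurePreserving_scalarB m n w l s i).quasiMeasurePreserving.ae_eq_comp
            (hΦ n (w + 1) l s μ)
        filter_upwards [ae_all_iff.2 this] with x hx
        simp only [Function.comp_def, Pi.zero_apply] at hx
        simp [chargeScalarB, Function.comp_def, hx]
  intro n w l s μ
  obtain ⟨h1, h2, h3, h4⟩ := h n w l s μ
  filter_upwards [h1, h2, h3, h4] with x e1 e2 e3 e4
  have : chargeFamily Φ.1 n w l s μ x = 0 := by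
    simp only [chargeFamily, Pi.add_apply, e1, e2, e3, e4, Pi.zero_apply, add_zero]
  exact this

/-- The formal action of the supercharge `Q` on classes of families of Borel functions. -/
def charge (m : ℝ) : Wave m →ₗ[ℂ] Wave m :=
  (null m).mapQ (null m) (chargeBorel m) (chargeBorel_null m)

/-! ### Domain, kernel and image of the supercharge -/

/-- The longitudinal projector `(Pψ)_μ(k) = m⁻² k_μ k^ν ψ_ν(k)` applied in each of the vector
variables `kᵢ`, `i ∈ S`. -/
def longitudinal {m : ℝ} (Φ : Family m) (n w l s : ℕ) (S : Finset (Fin n)) (μ : Fin n → Fin 4)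
    (x : Conf m n w l s) : ℂ :=
  ∑ ν : Fin n → Fin 4,
    (∏ i, if i ∈ S then lower (x.1 i) (μ i) * upper (x.1 i) (ν i) / (m : ℂ) ^ 2
      else if μ i = ν i then 1 else 0) * Φ n w l s ν x

theorem longitudinal_add {m : ℝ} (Φ Ψ : Family m) (n w l s : ℕ) (S : Finset (Fin n))
    (μ : Fin n → Fin 4) (x : Conf m n w l s) :
    longitudinal (Φ + Ψ) n w l s S μ x =
      longitudinal Φ n w l s S μ x + longitudinal Ψ n w l s S μ x := by
  simp only [longitudinal, Pi.add_apply, mul_add, Finset.sum_add_distrib]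

theorem longitudinal_smul {m : ℝ} (c : ℂ) (Φ : Family m) (n w l s : ℕ) (S : Finset (Fin n))
    (μ : Fin n → Fin 4) (x : Conf m n w l s) :
    longitudinal (c • Φ) n w l s S μ x = c * longitudinal Φ n w l s S μ x := by
  simp only [longitudinal, Pi.smul_apply, smul_eq_mul, mul_left_comm _ c, ← Finset.mul_sum]

theorem measurable_longitudinal {m : ℝ} {Φ : Family m} (hΦ : Φ ∈ borel m) (n w l s : ℕ)
    (S : Finset (Fin n)) (μ : Fin n → Fin 4) :
    Measurable (longitudinal Φ n w l s S μ) := by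
  refine Finset.measurable_fun_sum _ fun ν _ =>
    (Finset.measurable_fun_prod _ fun i _ => ?_).mul (hΦ _ _ _ _ _)
  split_ifs
  · exact (((measurable_lower (μ i)).comp (by fun_prop)).mul
      ((measurable_upper (ν i)).comp (by fun_prop))).div_const _
  · exact measurable_const
  · exact measurable_const

/-- Finite-particle states in `𝓗^{gh}` all of whose components remain square integrable when the
longitudinal projector is applied in any set of vector variables. -/
def finiteFamilies (m : ℝ) : Submodule ℂ (borel m) where
  carrier := {Φ | Φ ∈ ghostFamilies m ∧
    (∃ N : ℕ, ∀ n w l s, N < n + w + l + s → Φ.1 n w l s = 0) ∧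
    ∀ n w l s S μ, ∫⁻ x, ‖longitudinal Φ.1 n w l s S μ x‖ₑ ^ 2 ∂confMeasure m n w l s < ⊤}
  zero_mem' := ⟨Submodule.zero_mem _, ⟨0, fun _ _ _ _ _ => rfl⟩, fun _ _ _ _ _ _ => by
    simp [longitudinal]⟩
  add_mem' := by
    rintro a b ⟨ha, ⟨N, hN⟩, ha'⟩ ⟨hb, ⟨M, hM⟩, hb'⟩
    refine ⟨Submodule.add_mem _ ha hb, ⟨max N M, fun n w l s h => ?_⟩, fun n w l s S μ => ?_⟩
    · have h1 := hN n w l s ((le_max_left _ _).trans_lt h)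
      have h2 := hM n w l s ((le_max_right _ _).trans_lt h)
      simp only [Submodule.coe_add, Pi.add_apply, h1, h2, add_zero]
    · simp only [Submodule.coe_add, longitudinal_add]
      exact (lintegral_sq_add_le _ (measurable_longitudinal a.2 n w l s S μ)).trans_lt
        (ENNReal.add_lt_top.2 ⟨ENNReal.mul_lt_top (by norm_num) (ha' n w l s S μ),
          ENNReal.mul_lt_top (by norm_num) (hb' n w l s S μ)⟩)
  smul_mem' := by
    rintro c a ⟨ha, ⟨N, hN⟩, ha'⟩
    refine ⟨Submodule.smul_mem _ c ha, ⟨N, fun n w l s h => ?_⟩, fun n w l s S μ => ?_⟩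
    · simp only [Submodule.coe_smul, Pi.smul_apply, hN n w l s h, smul_zero]
    · simp only [Submodule.coe_smul, longitudinal_smul, lintegral_sq_smul]
      exact ENNReal.mul_lt_top (by simp) (ha' n w l s S μ)

/-- The subspace `𝓓` of `𝓗^{gh}` on which the supercharge is considered: sums of a transversal
ghost-free state and a finite-particle state with square integrable longitudinal parts.
`Q` is unbounded, so a domain has to be fixed. The one-particle projector `P` is oblique and
unbounded for the `ℂ⁴` scalar product, and a splitting `Ker(Q) = Im(Q) ⊕ 𝓗'` in the one-particle
sector forces the longitudinal parts of elements of `Ker(Q)` to be square integrable. The space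
contains `𝓗'` and all finite-particle states with compactly supported wave functions. -/
def admissible (m : ℝ) : Submodule ℂ (Wave m) :=
  (physical m).map (embed m) ⊔ (finiteFamilies m).map (null m).mkQ

theorem admissible_le_ghostFock (m : ℝ) : admissible m ≤ ghostFock m := by
  refine sup_le ?_ (Submodule.map_mono fun Φ hΦ => hΦ.1)
  rintro _ ⟨φ, hφ, rfl⟩
  exact embed_mem_ghostFock (physical_le_boseFock m hφ)

/-- The domain of the supercharge: the states `Φ ∈ 𝓓` with `QΦ ∈ 𝓓`. -/
def chargeDomain (m : ℝ) : Submodule ℂ (Wave m) :=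
  admissible m ⊓ (admissible m).comap (charge m)

/-- `Ker(Q)`. -/
def kerCharge (m : ℝ) : Submodule ℂ (Wave m) := chargeDomain m ⊓ LinearMap.ker (charge m)

/-- `Im(Q)`. -/
def imCharge (m : ℝ) : Submodule ℂ (Wave m) := (chargeDomain m).map (charge m)

end SpinOneBoson

end

noncomputable section

namespace SpinOneBoson

variable {m : ℝ}

/-! After removal of the factors √(n! w! l! s!), the supercharge is Q = C*D + E*B. Here D = L + im S
annihilates a longitudinal Boson or a Bosonic ghost, E* = -L* - im S* creates one, and B, C refer to
the two kinds of Fermionic ghosts. The contact term of L with L* is k^ν k_ν = m² and that of S with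
S* is 1, so the contact terms of D with E* add up to -m² - (im)² = 0. Together with Bose and Fermi
statistics this gives Q² = 0 (`rawCharge_rawCharge`).

The operator H = (im)⁻¹ S*C - m⁻² B*L is a contracting homotopy: QH + HQ = N, where N counts ghosts
and longitudinal vector Bosons (`rawCharge_rawHomotopy_add`, `rawNumber_eq`). These identities hold
pointwise for families of functions. A creation operator takes a family depending on a point of the
shell and evaluates it at a removed variable, so no integral or distribution occurs. Measure theory
enters only in the passage to classes and in square integrability.

At a fixed configuration N is the scalar w + l + s plus a sum of n commuting idempotents, the
longitudinal projectors. On a state with at most M particles it therefore satisfies X(X-1)⋯(X-M),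
where 0 is a simple root (`exists_aeval_number_eq_zero`). Its kernel in 𝓓₀ consists of transversal
states without ghosts (`mkQ_mem_physical_of_number_eq_zero`).

H and N preserve 𝓓₀; Q need not, because it multiplies by k_μ. The part of a state in ι(𝓗') may have
infinitely many particles, but Q kills it (`charge_embed`), so it can be split off. On 𝓓₀, take a
polynomial q with q(0) ≠ 0 and N q(N)x = 0. If x is closed, q(N)x/q(0) lies in ker N and differs
from x by Q(Hz) for some closed z (`exists_sub_mem_of_homotopy`); this gives surjectivity of 𝓗' →
Ker/Im. Injectivity uses that H also kills ι(𝓗'), in a form that never requires Qx to lie in 𝓓₀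
(`eq_zero_of_homotopy`). -/

/-! ### Annihilation and creation operators -/

/-- Annihilation of a longitudinal vector Boson, `k^ν A_ν(k)`, without normalization. -/
def annL (k : Shell m) : Family m →ₗ[ℂ] Family m where
  toFun Φ := fun n w l s μ x => ∑ ν : Fin 4, upper k ν *
    Φ (n + 1) w l s (Matrix.vecCons ν μ) (Matrix.vecCons k x.1, x.2)
  map_add' a b := by
    funext n w l s μ x
    simp only [Pi.add_apply, mul_add, Finset.sum_add_distrib]
  map_smul' c a := by
    funext n w l s μ x
    simp only [Pi.smul_apply, smul_eq_mul, RingHom.id_apply, mul_left_comm _ c, ← Finset.mul_sum]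

/-- Annihilation of a Fermionic ghost of the first kind. -/
def annB (k : Shell m) : Family m →ₗ[ℂ] Family m where
  toFun Φ := fun n w l s μ x => Φ n (w + 1) l s μ (x.1, Matrix.vecCons k x.2.1, x.2.2)
  map_add' _ _ := rfl
  map_smul' _ _ := rfl

/-- Annihilation of a Fermionic ghost of the second kind. -/
def annC (k : Shell m) : Family m →ₗ[ℂ] Family m where
  toFun Φ := fun n w l s μ x =>
    (-1) ^ w * Φ n w (l + 1) s μ (x.1, x.2.1, Matrix.vecCons k x.2.2.1, x.2.2.2)
  map_add' a b := by
    funext n w l s μ x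
    simp only [Pi.add_apply, mul_add]
  map_smul' c a := by
    funext n w l s μ x
    simp only [Pi.smul_apply, smul_eq_mul, RingHom.id_apply, mul_left_comm _ c]

/-- Annihilation of a Bosonic ghost. -/
def annS (k : Shell m) : Family m →ₗ[ℂ] Family m where
  toFun Φ := fun n w l s μ x => Φ n w l (s + 1) μ (x.1, x.2.1, x.2.2.1, Matrix.vecCons k x.2.2.2)
  map_add' _ _ := rfl
  map_smul' _ _ := rfl

/-- Creation of a longitudinal vector Boson. -/
def creL : (Shell m → Family m) →ₗ[ℂ] Family m where
  toFun g := fun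
    | 0, _, _, _ => fun _ _ => 0
    | n + 1, w, l, s => fun μ x => ∑ i : Fin (n + 1), lower (x.1 i) (μ i) *
        g (x.1 i) n w l s (μ ∘ i.succAbove) (x.1 ∘ i.succAbove, x.2)
  map_add' a b := by
    funext n w l s μ x
    rcases n with _ | n <;> simp [mul_add, Finset.sum_add_distrib]
  map_smul' c a := by
    funext n w l s μ x
    rcases n with _ | n <;> simp [mul_left_comm _ c, ← Finset.mul_sum]

/-- Creation of a Fermionic ghost of the first kind. -/
def creB : (Shell m → Family m) →ₗ[ℂ] Family m where
  toFun g := fun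
    | _, 0, _, _ => fun _ _ => 0
    | n, w + 1, l, s => fun μ x => ∑ i : Fin (w + 1), (-1) ^ (i : ℕ) *
        g (x.2.1 i) n w l s μ (x.1, x.2.1 ∘ i.succAbove, x.2.2)
  map_add' a b := by
    funext n w l s μ x
    rcases w with _ | w <;> simp [mul_add, Finset.sum_add_distrib]
  map_smul' c a := by
    funext n w l s μ x
    rcases w with _ | w <;> simp [mul_left_comm _ c, ← Finset.mul_sum]

/-- Creation of a Fermionic ghost of the second kind. -/
def creC : (Shell m → Family m) →ₗ[ℂ] Family m where
  toFun g := fun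
    | _, _, 0, _ => fun _ _ => 0
    | n, w, l + 1, s => fun μ x => (-1) ^ w * ∑ i : Fin (l + 1), (-1) ^ (i : ℕ) *
        g (x.2.2.1 i) n w l s μ (x.1, x.2.1, x.2.2.1 ∘ i.succAbove, x.2.2.2)
  map_add' a b := by
    funext n w l s μ x
    rcases l with _ | l <;> simp [mul_add, Finset.sum_add_distrib]
  map_smul' c a := by
    funext n w l s μ x
    rcases l with _ | l <;> simp [mul_left_comm _ c, ← Finset.mul_sum]

/-- Creation of a Bosonic ghost. -/
def creS : (Shell m → Family m) →ₗ[ℂ] Family m where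
  toFun g := fun
    | _, _, _, 0 => fun _ _ => 0
    | n, w, l, s + 1 => fun μ x => ∑ i : Fin (s + 1),
        g (x.2.2.2 i) n w l s μ (x.1, x.2.1, x.2.2.1, x.2.2.2 ∘ i.succAbove)
  map_add' a b := by
    funext n w l s μ x
    rcases s with _ | s <;> simp [Finset.sum_add_distrib]
  map_smul' c a := by
    funext n w l s μ x
    rcases s with _ | s <;> simp [← Finset.mul_sum]

theorem annL_apply (k : Shell m) (Φ : Family m) (n w l s : ℕ) (μ : Fin n → Fin 4)
    (x : Conf m n w l s) : annL k Φ n w l s μ x = ∑ ν : Fin 4, upper k ν *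
      Φ (n + 1) w l s (Matrix.vecCons ν μ) (Matrix.vecCons k x.1, x.2) := rfl

theorem annB_apply (k : Shell m) (Φ : Family m) (n w l s : ℕ) (μ : Fin n → Fin 4)
    (x : Conf m n w l s) :
    annB k Φ n w l s μ x = Φ n (w + 1) l s μ (x.1, Matrix.vecCons k x.2.1, x.2.2) := rfl

theorem annC_apply (k : Shell m) (Φ : Family m) (n w l s : ℕ) (μ : Fin n → Fin 4)
    (x : Conf m n w l s) : annC k Φ n w l s μ x =
      (-1) ^ w * Φ n w (l + 1) s μ (x.1, x.2.1, Matrix.vecCons k x.2.2.1, x.2.2.2) := rfl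

theorem annS_apply (k : Shell m) (Φ : Family m) (n w l s : ℕ) (μ : Fin n → Fin 4)
    (x : Conf m n w l s) : annS k Φ n w l s μ x =
      Φ n w l (s + 1) μ (x.1, x.2.1, x.2.2.1, Matrix.vecCons k x.2.2.2) := rfl

theorem creL_zero (g : Shell m → Family m) (w l s : ℕ) : creL g 0 w l s = 0 := rfl

theorem creB_zero (g : Shell m → Family m) (n l s : ℕ) : creB g n 0 l s = 0 := by
  cases n <;> rfl

theorem creC_zero (g : Shell m → Family m) (n w s : ℕ) : creC g n w 0 s = 0 := by
  cases n <;> cases w <;> rfl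

theorem creS_zero (g : Shell m → Family m) (n w l : ℕ) : creS g n w l 0 = 0 := by
  cases n <;> cases w <;> cases l <;> rfl

theorem creL_succ (g : Shell m → Family m) (n w l s : ℕ) (μ : Fin (n + 1) → Fin 4)
    (x : Conf m (n + 1) w l s) : creL g (n + 1) w l s μ x = ∑ i : Fin (n + 1),
      lower (x.1 i) (μ i) *
        g (x.1 i) n w l s (μ ∘ i.succAbove) (x.1 ∘ i.succAbove, x.2) := rfl

theorem creB_succ (g : Shell m → Family m) (n w l s : ℕ) (μ : Fin n → Fin 4)
    (x : Conf m n (w + 1) l s) : creB g n (w + 1) l s μ x = ∑ i : Fin (w + 1), (-1) ^ (i : ℕ) *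
      g (x.2.1 i) n w l s μ (x.1, x.2.1 ∘ i.succAbove, x.2.2) := rfl

theorem creC_succ (g : Shell m → Family m) (n w l s : ℕ) (μ : Fin n → Fin 4)
    (x : Conf m n w (l + 1) s) : creC g n w (l + 1) s μ x =
      (-1) ^ w * ∑ i : Fin (l + 1), (-1) ^ (i : ℕ) *
        g (x.2.2.1 i) n w l s μ (x.1, x.2.1, x.2.2.1 ∘ i.succAbove, x.2.2.2) := rfl

theorem creS_succ (g : Shell m → Family m) (n w l s : ℕ) (μ : Fin n → Fin 4)
    (x : Conf m n w l (s + 1)) : creS g n w l (s + 1) μ x = ∑ i : Fin (s + 1),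
      g (x.2.2.2 i) n w l s μ (x.1, x.2.1, x.2.2.1, x.2.2.2 ∘ i.succAbove) := rfl

/-- The mass shell condition; the contact term of longitudinal Bosons and the idempotency of the
longitudinal projector rest on it. -/
theorem sum_upper_mul_lower (k : Shell m) : ∑ ν, upper k ν * lower k ν = (m : ℂ) ^ 2 := by
  have h := k.2.1
  simp only [minkowski, Fin.sum_univ_three] at h
  rw [← Complex.ofReal_pow, ← h]
  simp [Fin.sum_univ_four, lower, upper]
  ring

theorem vecCons_comp_succ {α : Type*} {n : ℕ} (a : α) (f : Fin n → α) :
    Matrix.vecCons a f ∘ Fin.succ = f := rfl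

theorem vecCons_comp_succ_succAbove {α : Type*} {n : ℕ} (a : α) (f : Fin (n + 1) → α)
    (i : Fin (n + 1)) :
    Matrix.vecCons a f ∘ i.succ.succAbove = Matrix.vecCons a (f ∘ i.succAbove) := by
  funext j
  refine Fin.cases ?_ (fun j => ?_) j <;> simp

/-! ### Annihilation after creation -/

/-- Removing the newly added variable, at index 0, gives the contact term k^ν k_ν = m²; removing any
other variable commutes with the annihilation. The diagonal relations for the other particles arise
in the same way, with a sign for Fermionic ghosts because the old variables are shifted by one
place. -/
theorem annL_creL (k : Shell m) (g : Shell m → Family m) :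
    annL k (creL g) = (m : ℂ) ^ 2 • g k + creL fun p => annL k (g p) := by
  funext n w l s μ x
  simp only [annL_apply, creL_succ, Pi.add_apply, Pi.smul_apply, smul_eq_mul,
    Fin.sum_univ_succ (n := n), mul_add, Finset.sum_add_distrib, Matrix.cons_val_zero,
    Matrix.cons_val_succ, Fin.succAbove_zero, vecCons_comp_succ]
  congr 1
  · rw [← sum_upper_mul_lower k, Finset.sum_mul]
    exact Finset.sum_congr rfl fun ν _ => by ring
  · rcases n with _ | n
    · simp [creL_zero]
    · simp only [creL_succ, vecCons_comp_succ_succAbove, annL_apply, Finset.mul_sum]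
      rw [Finset.sum_comm]
      exact Finset.sum_congr rfl fun i _ => Finset.sum_congr rfl fun ν _ => by ring

theorem annB_creB (k : Shell m) (g : Shell m → Family m) :
    annB k (creB g) = g k - creB fun p => annB k (g p) := by
  funext n w l s μ x
  simp only [annB_apply, creB_succ, Pi.sub_apply, Fin.sum_univ_succ (n := w),
    Matrix.cons_val_zero, Matrix.cons_val_succ, Fin.succAbove_zero, vecCons_comp_succ,
    Fin.val_zero, pow_zero, one_mul, sub_eq_add_neg]
  congr 1
  rcases w with _ | w
  · simp [creB_zero]
  · simp only [creB_succ, vecCons_comp_succ_succAbove, annB_apply, ← Finset.sum_neg_distrib,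
      Fin.val_succ, pow_succ, mul_neg, mul_one, neg_mul]

theorem annC_creC (k : Shell m) (g : Shell m → Family m) :
    annC k (creC g) = g k - creC fun p => annC k (g p) := by
  funext n w l s μ x
  have h : ((-1 : ℂ) ^ w) * (-1) ^ w = 1 := by rw [← mul_pow]; simp
  simp only [annC_apply, creC_succ, Pi.sub_apply, Fin.sum_univ_succ (n := l),
    Matrix.cons_val_zero, Matrix.cons_val_succ, Fin.succAbove_zero, vecCons_comp_succ,
    Fin.val_zero, pow_zero, one_mul, sub_eq_add_neg, ← mul_assoc, h]
  congr 1
  rcases l with _ | l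
  · simp [creC_zero]
  · simp only [creC_succ, vecCons_comp_succ_succAbove, annC_apply, ← Finset.sum_neg_distrib,
      Fin.val_succ, pow_succ, mul_neg, mul_one, neg_mul, Finset.mul_sum]
    refine Finset.sum_congr rfl fun i _ => ?_
    linear_combination (-1) ^ (i : ℕ) * g (x.2.2.1 i) n w (l + 1) s μ
      (x.1, x.2.1, Matrix.vecCons k (x.2.2.1 ∘ i.succAbove), x.2.2.2) * h

theorem annS_creS (k : Shell m) (g : Shell m → Family m) :
    annS k (creS g) = g k + creS fun p => annS k (g p) := by
  funext n w l s μ x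
  simp only [annS_apply, creS_succ, Pi.add_apply, Fin.sum_univ_succ (n := s),
    Matrix.cons_val_zero, Matrix.cons_val_succ, Fin.succAbove_zero, vecCons_comp_succ]
  congr 1
  rcases s with _ | s
  · simp [creS_zero]
  · simp only [creS_succ, vecCons_comp_succ_succAbove, annS_apply]

theorem annL_creB (k : Shell m) (g : Shell m → Family m) :
    annL k (creB g) = creB fun p => annL k (g p) := by
  funext n w l s μ x
  rcases w with _ | w
  · simp [annL_apply, creB_zero]
  · simp only [annL_apply, creB_succ, Finset.mul_sum]
    rw [Finset.sum_comm]
    exact Finset.sum_congr rfl fun i _ => Finset.sum_congr rfl fun ν _ => by ring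

theorem annL_creC (k : Shell m) (g : Shell m → Family m) :
    annL k (creC g) = creC fun p => annL k (g p) := by
  funext n w l s μ x
  rcases l with _ | l
  · simp [annL_apply, creC_zero]
  · simp only [annL_apply, creC_succ, Finset.mul_sum]
    rw [Finset.sum_comm]
    exact Finset.sum_congr rfl fun i _ => Finset.sum_congr rfl fun ν _ => by ring

theorem annL_creS (k : Shell m) (g : Shell m → Family m) :
    annL k (creS g) = creS fun p => annL k (g p) := by
  funext n w l s μ x
  rcases s with _ | s
  · simp [annL_apply, creS_zero]
  · simp only [annL_apply, creS_succ, Finset.mul_sum]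
    rw [Finset.sum_comm]

theorem annB_creL (k : Shell m) (g : Shell m → Family m) :
    annB k (creL g) = creL fun p => annB k (g p) := by
  funext n w l s μ x
  rcases n with _ | n <;> rfl

/-- `annB` reads the family at w + 1, which flips the factor (-1)^w in `creC`. This factor makes the
two kinds of Fermionic ghosts anticommute. -/
theorem annB_creC (k : Shell m) (g : Shell m → Family m) :
    annB k (creC g) = -creC fun p => annB k (g p) := by
  funext n w l s μ x
  rcases l with _ | l
  · simp [annB_apply, creC_zero]
  · simp only [annB_apply, creC_succ, Pi.neg_apply, pow_succ]
    ring

theorem annB_creS (k : Shell m) (g : Shell m → Family m) :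
    annB k (creS g) = creS fun p => annB k (g p) := by
  funext n w l s μ x
  rcases s with _ | s
  · simp [annB_apply, creS_zero]
  · rfl

theorem annC_creL (k : Shell m) (g : Shell m → Family m) :
    annC k (creL g) = creL fun p => annC k (g p) := by
  funext n w l s μ x
  rcases n with _ | n
  · simp [annC_apply, creL_zero]
  · simp only [annC_apply, creL_succ, Finset.mul_sum]
    exact Finset.sum_congr rfl fun i _ => mul_left_comm _ _ _

theorem annC_creS (k : Shell m) (g : Shell m → Family m) :
    annC k (creS g) = creS fun p => annC k (g p) := by
  funext n w l s μ x
  rcases s with _ | s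
  · simp [annC_apply, creS_zero]
  · simp only [annC_apply, creS_succ, Finset.mul_sum]

theorem annS_creL (k : Shell m) (g : Shell m → Family m) :
    annS k (creL g) = creL fun p => annS k (g p) := by
  funext n w l s μ x
  rcases n with _ | n <;> rfl

theorem annS_creB (k : Shell m) (g : Shell m → Family m) :
    annS k (creB g) = creB fun p => annS k (g p) := by
  funext n w l s μ x
  rcases w with _ | w
  · simp [annS_apply, creB_zero]
  · rfl

theorem annS_creC (k : Shell m) (g : Shell m → Family m) :
    annS k (creC g) = creC fun p => annS k (g p) := by
  funext n w l s μ x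
  rcases l with _ | l
  · simp [annS_apply, creC_zero]
  · rfl

/-! ### Iterated creation -/

/-- Exchange of the order in which two entries of a tuple are removed. -/
theorem sum_sum_succAbove_comm {M : Type*} [AddCommMonoid M] {n : ℕ}
    (F : Fin (n + 2) → Fin (n + 1) → M) :
    ∑ i, ∑ j, F i j = ∑ i : Fin (n + 2), ∑ j : Fin (n + 1), F (i.succAbove j) (j.predAbove i) := by
  simp only [← Fintype.sum_prod_type']
  -- The pair (i, j) stands for removing entry i and then entry `i.succAbove j`; the involution
  -- lists the same two entries in the opposite order.
  have h : Function.Involutive fun p : Fin (n + 2) × Fin (n + 1) =>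
      (p.1.succAbove p.2, p.2.predAbove p.1) := fun p =>
    Prod.ext (Fin.succAbove_succAbove_predAbove p.1 p.2)
      (Fin.predAbove_predAbove_succAbove p.1 p.2)
  exact (Equiv.sum_comp h.toPerm fun p : Fin (n + 2) × Fin (n + 1) => F p.1 p.2).symm

theorem comp_succAbove_comp_succAbove {α : Type*} {n : ℕ} (f : Fin (n + 2) → α) (i : Fin (n + 2))
    (j : Fin (n + 1)) :
    (f ∘ (i.succAbove j).succAbove) ∘ (j.predAbove i).succAbove =
      (f ∘ i.succAbove) ∘ j.succAbove := by
  funext a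
  simp [Fin.succAbove_succAbove_succAbove_predAbove]

theorem creL_creL (g : Shell m → Shell m → Family m) :
    (creL fun k => creL fun p => g k p) = creL fun p => creL fun k => g k p := by
  funext n w l s μ x
  rcases n with _ | _ | n
  · rfl
  · simp [creL_succ, creL_zero]
  · simp only [creL_succ, Finset.mul_sum]
    rw [sum_sum_succAbove_comm]
    refine Finset.sum_congr rfl fun i _ => Finset.sum_congr rfl fun j _ => ?_
    simp only [comp_succAbove_comp_succAbove]
    simp only [Function.comp_apply, Fin.succAbove_succAbove_predAbove]
    ring

theorem creS_creS (g : Shell m → Shell m → Family m) :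
    (creS fun k => creS fun p => g k p) = creS fun p => creS fun k => g k p := by
  funext n w l s μ x
  rcases s with _ | _ | s
  · simp [creS_zero]
  · simp [creS_succ, creS_zero]
  · simp only [creS_succ]
    rw [sum_sum_succAbove_comm]
    refine Finset.sum_congr rfl fun i _ => Finset.sum_congr rfl fun j _ => ?_
    simp only [comp_succAbove_comp_succAbove]
    simp only [Function.comp_apply, Fin.succAbove_succAbove_predAbove]

theorem creC_creC (g : Shell m → Shell m → Family m) :
    (creC fun k => creC fun p => g k p) = -creC fun p => creC fun k => g k p := by
  funext n w l s μ x
  rcases l with _ | _ | l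
  · simp [creC_zero]
  · simp [creC_succ, creC_zero]
  · simp only [creC_succ, Finset.mul_sum, Pi.neg_apply, ← Finset.sum_neg_distrib]
    rw [sum_sum_succAbove_comm]
    refine Finset.sum_congr rfl fun i _ => Finset.sum_congr rfl fun j _ => ?_
    simp only [comp_succAbove_comp_succAbove]
    simp only [Function.comp_apply, Fin.succAbove_succAbove_predAbove]
    -- Exchanging the order of removal changes the parity of the sum of the two positions, whence
    -- the anticommutation.
    have h := Fin.neg_one_pow_succAbove_add_predAbove (R := ℂ) i j
    rw [pow_add, pow_add] at h
    linear_combination ((-1) ^ w) ^ 2 * g (x.2.2.1 (i.succAbove j)) (x.2.2.1 i) n w l s μ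
      (x.1, x.2.1, (x.2.2.1 ∘ i.succAbove) ∘ j.succAbove, x.2.2.2) * h

theorem creL_creS (g : Shell m → Shell m → Family m) :
    (creL fun k => creS fun p => g k p) = creS fun p => creL fun k => g k p := by
  funext n w l s μ x
  rcases n with _ | n <;> rcases s with _ | s
  · rfl
  · simp [creL_zero, creS_succ]
  · simp [creL_succ, creS_zero]
  · simp only [creL_succ, creS_succ, Finset.mul_sum]
    exact Finset.sum_comm

theorem creC_creL (g : Shell m → Shell m → Family m) :
    (creC fun k => creL fun p => g k p) = creL fun p => creC fun k => g k p := by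
  funext n w l s μ x
  rcases n with _ | n <;> rcases l with _ | l
  · simp [creL_zero, creC_zero]
  · simp [creL_zero, creC_succ]
  · simp [creL_succ, creC_zero]
  · simp only [creL_succ, creC_succ, Finset.mul_sum]
    rw [Finset.sum_comm]
    exact Finset.sum_congr rfl fun i _ => Finset.sum_congr rfl fun j _ => by ring

theorem creC_creS (g : Shell m → Shell m → Family m) :
    (creC fun k => creS fun p => g k p) = creS fun p => creC fun k => g k p := by
  funext n w l s μ x
  rcases s with _ | s <;> rcases l with _ | l
  · simp [creS_zero, creC_zero]
  · simp [creS_zero, creC_succ]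
  · simp [creS_succ, creC_zero]
  · simp only [creS_succ, creC_succ, Finset.mul_sum]
    rw [Finset.sum_comm]

theorem creB_creL (g : Shell m → Shell m → Family m) :
    (creB fun k => creL fun p => g k p) = creL fun p => creB fun k => g k p := by
  funext n w l s μ x
  rcases n with _ | n <;> rcases w with _ | w
  · simp [creL_zero, creB_zero]
  · simp [creL_zero, creB_succ]
  · simp [creL_succ, creB_zero]
  · simp only [creL_succ, creB_succ, Finset.mul_sum]
    rw [Finset.sum_comm]
    exact Finset.sum_congr rfl fun i _ => Finset.sum_congr rfl fun j _ => by ring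

theorem creB_creS (g : Shell m → Shell m → Family m) :
    (creB fun k => creS fun p => g k p) = creS fun p => creB fun k => g k p := by
  funext n w l s μ x
  rcases s with _ | s <;> rcases w with _ | w
  · simp [creS_zero, creB_zero]
  · simp [creS_zero, creB_succ]
  · simp [creS_succ, creB_zero]
  · simp only [creS_succ, creB_succ, Finset.mul_sum]
    rw [Finset.sum_comm]

theorem creC_creB (g : Shell m → Shell m → Family m) :
    (creC fun k => creB fun p => g k p) = -creB fun p => creC fun k => g k p := by
  funext n w l s μ x
  rcases w with _ | w <;> rcases l with _ | l
  · simp [creB_zero, creC_zero]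
  · simp [creB_zero, creC_succ]
  · simp [creB_succ, creC_zero]
  · simp only [creB_succ, creC_succ, Finset.mul_sum, Pi.neg_apply, ← Finset.sum_neg_distrib]
    rw [Finset.sum_comm]
    exact Finset.sum_congr rfl fun i _ => Finset.sum_congr rfl fun j _ => by ring

/-! ### Iterated annihilation -/

theorem annL_annB (k p : Shell m) (Φ : Family m) : annL k (annB p Φ) = annB p (annL k Φ) := rfl

theorem annS_annB (k p : Shell m) (Φ : Family m) : annS k (annB p Φ) = annB p (annS k Φ) := rfl

theorem annS_annC (k p : Shell m) (Φ : Family m) : annS k (annC p Φ) = annC p (annS k Φ) := rfl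

theorem annL_annS (k p : Shell m) (Φ : Family m) : annL k (annS p Φ) = annS p (annL k Φ) := rfl

theorem annL_annC (k p : Shell m) (Φ : Family m) : annL k (annC p Φ) = annC p (annL k Φ) := by
  funext n w l s μ x
  simp only [annL_apply, annC_apply, Finset.mul_sum]
  exact Finset.sum_congr rfl fun i _ => mul_left_comm _ _ _

theorem annB_annC (k p : Shell m) (Φ : Family m) : annB k (annC p Φ) = -annC p (annB k Φ) := by
  funext n w l s μ x
  simp only [annB_apply, annC_apply, Pi.neg_apply, pow_succ]
  ring

theorem vecCons_vecCons_comp_swap {α : Type*} {n : ℕ} (a b : α) (f : Fin n → α) :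
    Matrix.vecCons a (Matrix.vecCons b f) ∘ Equiv.swap (0 : Fin (n + 2)) 1 =
      Matrix.vecCons b (Matrix.vecCons a f) := by
  funext i
  refine Fin.cases ?_ (fun i => Fin.cases ?_ (fun i => ?_) i) i
  · simp
  · simp
  · have : Equiv.swap (0 : Fin (n + 2)) 1 i.succ.succ = i.succ.succ :=
      Equiv.swap_apply_of_ne_of_ne (Fin.succ_ne_zero _) (by simp [Fin.ext_iff])
    simp [this]

/-- Here the symmetry of `Φ` enters: the transposition of the two leading entries is applied to
indices and momenta together. -/
theorem annL_annL {Φ : Family m} (hΦ : IsSymm Φ) (k p : Shell m) :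
    annL k (annL p Φ) = annL p (annL k Φ) := by
  funext n w l s μ x
  simp only [annL_apply, Finset.mul_sum]
  rw [Finset.sum_comm]
  refine Finset.sum_congr rfl fun i _ => Finset.sum_congr rfl fun j _ => ?_
  have h := hΦ (n + 2) w l s (Equiv.swap 0 1) 1 1 1 (Matrix.vecCons i (Matrix.vecCons j μ))
    (Matrix.vecCons p (Matrix.vecCons k x.1), x.2)
  simp only [vecCons_vecCons_comp_swap, Equiv.Perm.sign_one, Units.val_one, Int.cast_one, one_mul,
    Equiv.Perm.coe_one, Function.comp_id] at h
  rw [h]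
  ring

theorem annS_annS {Φ : Family m} (hΦ : IsSymm Φ) (k p : Shell m) :
    annS k (annS p Φ) = annS p (annS k Φ) := by
  funext n w l s μ x
  have h := hΦ n w l (s + 2) 1 1 1 (Equiv.swap 0 1) μ
    (x.1, x.2.1, x.2.2.1, Matrix.vecCons k (Matrix.vecCons p x.2.2.2))
  simp only [vecCons_vecCons_comp_swap, Equiv.Perm.sign_one, Units.val_one, Int.cast_one, one_mul,
    Equiv.Perm.coe_one, Function.comp_id] at h
  exact h

theorem annB_annB {Φ : Family m} (hΦ : IsSymm Φ) (k p : Shell m) :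
    annB k (annB p Φ) = -annB p (annB k Φ) := by
  funext n w l s μ x
  have h := hΦ n (w + 2) l s 1 (Equiv.swap 0 1) 1 1 μ
    (x.1, Matrix.vecCons k (Matrix.vecCons p x.2.1), x.2.2)
  simp only [vecCons_vecCons_comp_swap, Equiv.Perm.sign_one, Units.val_one, Int.cast_one, one_mul,
    Equiv.Perm.coe_one, Function.comp_id, mul_one, Equiv.Perm.sign_swap (Fin.zero_ne_one),
    Units.val_neg, Int.cast_neg, neg_mul] at h
  exact h

/-! ### The supercharge and its homotopy without normalization factors -/

section Linearity

variable (c : ℂ) (f g : Shell m → Family m)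

theorem creB_add : creB (fun k => f k + g k) = creB f + creB g := map_add creB f g

theorem creC_add : creC (fun k => f k + g k) = creC f + creC g := map_add creC f g

theorem creS_add : creS (fun k => f k + g k) = creS f + creS g := map_add creS f g

theorem creL_neg : creL (fun k => -f k) = -creL f := map_neg creL f

theorem creB_neg : creB (fun k => -f k) = -creB f := map_neg creB f

theorem creC_neg : creC (fun k => -f k) = -creC f := map_neg creC f

theorem creS_neg : creS (fun k => -f k) = -creS f := map_neg creS f

theorem creL_sub : creL (fun k => f k - g k) = creL f - creL g := map_sub creL f g

theorem creB_sub : creB (fun k => f k - g k) = creB f - creB g := map_sub creB f g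

theorem creC_sub : creC (fun k => f k - g k) = creC f - creC g := map_sub creC f g

theorem creS_sub : creS (fun k => f k - g k) = creS f - creS g := map_sub creS f g

theorem creL_smul : creL (fun k => c • g k) = c • creL g := map_smul creL c g

theorem creB_smul : creB (fun k => c • g k) = c • creB g := map_smul creB c g

theorem creC_smul : creC (fun k => c • g k) = c • creC g := map_smul creC c g

theorem creS_smul : creS (fun k => c • g k) = c • creS g := map_smul creS c g

end Linearity

/-! ### The building blocks D and E* of the supercharge -/

/-- The combination `k^μ A_μ(k) + im a(k)` of annihilation operators. -/
def annD (k : Shell m) : Family m →ₗ[ℂ] Family m := annL k + (Complex.I * m) • annS k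

/-- The combination of creation operators conjugate to `annD`. -/
def creE : (Shell m → Family m) →ₗ[ℂ] Family m := -creL - (Complex.I * m) • creS

theorem annD_apply (k : Shell m) (Φ : Family m) :
    annD k Φ = annL k Φ + (Complex.I * m) • annS k Φ := rfl

theorem creE_apply (g : Shell m → Family m) : creE g = -creL g - (Complex.I * m) • creS g := rfl

theorem creE_add (f g : Shell m → Family m) : creE (fun k => f k + g k) = creE f + creE g :=
  map_add creE f g

theorem creE_smul (c : ℂ) (g : Shell m → Family m) : creE (fun k => c • g k) = c • creE g :=
  map_smul creE c g

theorem creE_neg (g : Shell m → Family m) : creE (fun k => -g k) = -creE g := map_neg creE g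

theorem creE_sub (f g : Shell m → Family m) : creE (fun k => f k - g k) = creE f - creE g :=
  map_sub creE f g

theorem I_mul_mul_I_mul (m : ℝ) : (Complex.I * m) * (Complex.I * m) = -(m : ℂ) ^ 2 := by
  linear_combination (m : ℂ) ^ 2 * Complex.I_mul_I

theorem annL_creE (k : Shell m) (g : Shell m → Family m) :
    annL k (creE g) = -(m : ℂ) ^ 2 • g k + creE fun p => annL k (g p) := by
  simp only [creE_apply, map_sub, map_neg, map_smul, annL_creL, annL_creS]
  module

theorem annS_creE (k : Shell m) (g : Shell m → Family m) :
    annS k (creE g) = -(Complex.I * m) • g k + creE fun p => annS k (g p) := by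
  simp only [creE_apply, map_sub, map_neg, map_smul, annS_creL, annS_creS]
  module

/-- The contact terms -m² from the vector Boson and -(im)² = m² from the Bosonic ghost cancel. This
is why a Bosonic ghost with coupling im makes the supercharge nilpotent in the massive case. -/
theorem annD_creE (k : Shell m) (g : Shell m → Family m) :
    annD k (creE g) = creE fun p => annD k (g p) := by
  simp only [annD_apply, annL_creE, annS_creE, creE_add, creE_smul]
  linear_combination (norm := module) -(I_mul_mul_I_mul m) • g k

theorem annD_creS (k : Shell m) (g : Shell m → Family m) :
    annD k (creS g) = (Complex.I * m) • g k + creS fun p => annD k (g p) := by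
  simp only [annD_apply, annL_creS, annS_creS, creS_add, creS_smul]
  module

theorem annD_creC (k : Shell m) (g : Shell m → Family m) :
    annD k (creC g) = creC fun p => annD k (g p) := by
  simp only [annD_apply, annL_creC, annS_creC, creC_add, creC_smul]

theorem annD_creB (k : Shell m) (g : Shell m → Family m) :
    annD k (creB g) = creB fun p => annD k (g p) := by
  simp only [annD_apply, annL_creB, annS_creB, creB_add, creB_smul]

theorem annB_creE (k : Shell m) (g : Shell m → Family m) :
    annB k (creE g) = creE fun p => annB k (g p) := by
  simp only [creE_apply, map_sub, map_neg, map_smul, annB_creL, annB_creS]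

theorem annC_creE (k : Shell m) (g : Shell m → Family m) :
    annC k (creE g) = creE fun p => annC k (g p) := by
  simp only [creE_apply, map_sub, map_neg, map_smul, annC_creL, annC_creS]

theorem annD_annB (k p : Shell m) (Φ : Family m) : annD k (annB p Φ) = annB p (annD k Φ) := by
  simp only [annD_apply, annL_annB, annS_annB, map_add, map_smul]

theorem annD_annC (k p : Shell m) (Φ : Family m) : annD k (annC p Φ) = annC p (annD k Φ) := by
  simp only [annD_apply, annL_annC, annS_annC, map_add, map_smul]

theorem annD_annL {Φ : Family m} (hΦ : IsSymm Φ) (k p : Shell m) :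
    annD k (annL p Φ) = annL p (annD k Φ) := by
  simp only [annD_apply, map_add, map_smul, annL_annL hΦ k p, annL_annS]

theorem annD_annD {Φ : Family m} (hΦ : IsSymm Φ) (k p : Shell m) :
    annD k (annD p Φ) = annD p (annD k Φ) := by
  rw [annD_apply p, annD_apply p, map_add, map_smul, annD_annL hΦ]
  congr 2
  simp only [annD_apply, map_add, map_smul, annS_annS hΦ k p, annL_annS]

theorem creE_creE (g : Shell m → Shell m → Family m) :
    (creE fun k => creE fun p => g k p) = creE fun p => creE fun k => g k p := by
  simp only [creE_apply, creL_sub, creL_neg, creL_smul, creS_sub, creS_neg, creS_smul]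
  rw [creL_creL, creS_creS, creL_creS, creL_creS]
  module

theorem creC_creE (g : Shell m → Shell m → Family m) :
    (creC fun k => creE fun p => g k p) = creE fun p => creC fun k => g k p := by
  simp only [creE_apply, creC_sub, creC_neg, creC_smul]
  rw [creC_creL, creC_creS]

theorem creB_creE (g : Shell m → Shell m → Family m) :
    (creB fun k => creE fun p => g k p) = creE fun p => creB fun k => g k p := by
  simp only [creE_apply, creB_sub, creB_neg, creB_smul]
  rw [creB_creL, creB_creS]

theorem creS_creE (g : Shell m → Shell m → Family m) :
    (creS fun k => creE fun p => g k p) = creE fun p => creS fun k => g k p := by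
  simp only [creE_apply, creS_sub, creS_neg, creS_smul]
  rw [creS_creS, ← creL_creS]

/-! ### Nilpotency and the homotopy identity -/

/-- The supercharge up to the normalization of components. -/
def rawCharge (Φ : Family m) : Family m :=
  creC (fun k => annD k Φ) + creE fun k => annB k Φ

/-- The contracting homotopy up to the normalization of components. -/
def rawHomotopy (Φ : Family m) : Family m :=
  (Complex.I * m)⁻¹ • creS (fun k => annC k Φ) - ((m : ℂ) ^ 2)⁻¹ • creB fun k => annL k Φ

/-- The operator that counts the ghosts and the longitudinal vector Bosons. -/
def rawNumber (Φ : Family m) : Family m :=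
  ((m : ℂ) ^ 2)⁻¹ • creL (fun k => annL k Φ) + creB (fun k => annB k Φ) +
    creC (fun k => annC k Φ) + creS fun k => annS k Φ

/-- C*C* is antisymmetric while DD is symmetric, and E*E* is symmetric while BB is antisymmetric, so
both squares vanish. The mixed terms cancel because D commutes with E* and B anticommutes with C*.
-/
theorem rawCharge_rawCharge {Φ : Family m} (hΦ : IsSymm Φ) : rawCharge (rawCharge Φ) = 0 := by
  -- The expression equals its own negative; likewise in `h2`.
  have h1 : (creC fun k => creC fun p => annD k (annD p Φ)) = 0 := by
    rw [← self_eq_neg]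
    conv_rhs => rw [← creC_creC fun p k => annD k (annD p Φ)]
    simp only [annD_annD hΦ]
  have h2 : (creE fun k => creE fun p => annB k (annB p Φ)) = 0 := by
    rw [← self_eq_neg, ← creE_neg]
    simp only [← creE_neg, ← annB_annB hΦ]
    exact creE_creE _
  simp only [rawCharge, map_add, annD_creC, annD_creE, annB_creC, annB_creE, creC_add, creE_add,
    creE_neg, h1, h2]
  rw [creC_creE]
  simp only [annD_annB]
  abel

/-- All terms without a contact term cancel by the statistics. What remains is one contact term for
each matching pair of operators in Q and H. -/
theorem rawCharge_rawHomotopy_add (hm : m ≠ 0) {Φ : Family m} (hΦ : IsSymm Φ) :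
    rawCharge (rawHomotopy Φ) + rawHomotopy (rawCharge Φ) = rawNumber Φ := by
  have hc : (m : ℂ) ≠ 0 := by exact_mod_cast hm
  have hI : Complex.I * m ≠ 0 := mul_ne_zero Complex.I_ne_zero hc
  -- Anticommutator of Q with S*C: contact terms of D with S* (factor im) and of C with C* (factor
  -- 1).
  have hS : creC (fun k => annD k (creS fun p => annC p Φ)) +
      creE (fun k => annB k (creS fun p => annC p Φ)) +
      creS (fun k => annC k (rawCharge Φ)) =
      (Complex.I * m) • creC (fun k => annC k Φ) + creS fun k => annD k Φ := by
    simp only [rawCharge, map_add, annD_creS, annB_creS, annC_creC, annC_creE, creC_add, creS_add,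
      creS_sub, creC_smul, annB_annC, creS_neg, creE_neg]
    rw [creC_creS, creS_creE]
    simp only [annD_annC]
    module
  -- Anticommutator of Q with B*L: contact terms of B with B* (factor 1) and of L with E* (factor
  -- -m²).
  have hB : creC (fun k => annD k (creB fun p => annL p Φ)) +
      creE (fun k => annB k (creB fun p => annL p Φ)) +
      creB (fun k => annL k (rawCharge Φ)) =
      creE (fun k => annL k Φ) - (m : ℂ) ^ 2 • creB fun k => annB k Φ := by
    simp only [rawCharge, map_add, annD_creB, annB_creB, annL_creC, annL_creE, creB_add,
      creE_sub]
    rw [creC_creB, creB_creE]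
    have h : creB (fun p => -(m : ℂ) ^ 2 • annB p Φ) = -(m : ℂ) ^ 2 • creB fun p => annB p Φ :=
      creB_smul _ _
    simp only [annD_annL hΦ, annL_annB, h]
    module
  have e : rawCharge (rawHomotopy Φ) + rawHomotopy (rawCharge Φ) =
      (Complex.I * m)⁻¹ • (creC (fun k => annD k (creS fun p => annC p Φ)) +
        creE (fun k => annB k (creS fun p => annC p Φ)) +
        creS (fun k => annC k (rawCharge Φ))) -
      ((m : ℂ) ^ 2)⁻¹ • (creC (fun k => annD k (creB fun p => annL p Φ)) +
        creE (fun k => annB k (creB fun p => annL p Φ)) +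
        creB (fun k => annL k (rawCharge Φ))) := by
    have h (f g : Shell m → Family m) (a b : ℂ) :
        creE (fun k => a • f k - b • g k) = a • creE f - b • creE g := by
      rw [← map_smul, ← map_smul, ← map_sub]
      rfl
    rw [rawCharge, rawHomotopy, rawHomotopy]
    simp only [map_sub, map_smul, creC_sub, creC_smul, h]
    module
  rw [e, hS, hB, rawNumber]
  simp only [annD_apply, creS_add, creS_smul, creE_apply, smul_add, smul_sub, smul_smul, smul_neg,
    inv_mul_cancel₀ hI, inv_mul_cancel₀ (pow_ne_zero 2 hc), one_smul]
  -- The off-diagonal term S*L arises from both anticommutators; the relative coefficient of the two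
  -- parts of H makes it cancel.
  have h : (Complex.I * m)⁻¹ + ((m : ℂ) ^ 2)⁻¹ * (Complex.I * m) = 0 := by
    field_simp
    linear_combination Complex.I_sq
  generalize (Complex.I * (m : ℂ))⁻¹ = a at h ⊢
  linear_combination (norm := module) h • creS fun k => annL k Φ

/-! ### Normalization factors -/

/-- The normalization factor `√(n! w! l! s!)`. -/
def weight (n w l s : ℕ) : ℂ :=
  (√((n.factorial : ℝ) * w.factorial * l.factorial * s.factorial) : ℝ)

theorem weight_ne_zero (n w l s : ℕ) : weight n w l s ≠ 0 := by
  unfold weight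
  have : 0 < (n.factorial : ℝ) * w.factorial * l.factorial * s.factorial := by positivity
  exact_mod_cast (Real.sqrt_pos.2 this).ne'

/-- Multiplication by the normalization factors. -/
def scale : Family m →ₗ[ℂ] Family m where
  toFun Φ := fun n w l s μ x => weight n w l s * Φ n w l s μ x
  map_add' a b := by
    funext n w l s μ x
    simp only [Pi.add_apply, mul_add]
  map_smul' c a := by
    funext n w l s μ x
    simp only [Pi.smul_apply, smul_eq_mul, RingHom.id_apply, mul_left_comm _ c]

/-- Division by the normalization factors. -/
def unscale : Family m →ₗ[ℂ] Family m where
  toFun Φ := fun n w l s μ x => (weight n w l s)⁻¹ * Φ n w l s μ x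
  map_add' a b := by
    funext n w l s μ x
    simp only [Pi.add_apply, mul_add]
  map_smul' c a := by
    funext n w l s μ x
    simp only [Pi.smul_apply, smul_eq_mul, RingHom.id_apply, mul_left_comm _ c]

theorem scale_apply (Φ : Family m) (n w l s : ℕ) (μ : Fin n → Fin 4) (x : Conf m n w l s) :
    scale Φ n w l s μ x = weight n w l s * Φ n w l s μ x := rfl

theorem unscale_apply (Φ : Family m) (n w l s : ℕ) (μ : Fin n → Fin 4) (x : Conf m n w l s) :
    unscale Φ n w l s μ x = (weight n w l s)⁻¹ * Φ n w l s μ x := rfl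

theorem unscale_scale (Φ : Family m) : unscale (scale Φ) = Φ := by
  funext n w l s μ x
  rw [unscale_apply, scale_apply, inv_mul_cancel_left₀ (weight_ne_zero n w l s)]

theorem scale_unscale (Φ : Family m) : scale (unscale Φ) = Φ := by
  funext n w l s μ x
  rw [scale_apply, unscale_apply, mul_inv_cancel_left₀ (weight_ne_zero n w l s)]

theorem IsSymm.scale {Φ : Family m} (hΦ : IsSymm Φ) : IsSymm (scale Φ) := by
  intro n w l s π σ τ θ μ x
  rw [scale_apply, scale_apply, hΦ n w l s π σ τ θ μ x]
  ring

theorem sqrt_div_mul_weight {a b c d : ℝ} (hb : 0 < b) (hc : 0 ≤ c) (h : a * c = b * d) :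
    ((√(a / b) : ℝ) : ℂ) * (√c : ℝ) = (√d : ℝ) := by
  rw [← Complex.ofReal_mul, ← Real.sqrt_mul' _ hc]
  congr 2
  field_simp
  linarith

/-- Each square root in the supercharge is the quotient of the weights of the source and target
components, so conjugation by `scale` removes it. -/
theorem scale_chargeFamily (Φ : Family m) : scale (chargeFamily Φ) = rawCharge (scale Φ) := by
  have h1 (n w l s : ℕ) : (√((n + 1 : ℝ) / (l + 1 : ℝ)) : ℂ) * weight n w (l + 1) s =
      weight (n + 1) w l s :=
    sqrt_div_mul_weight (by positivity) (by positivity) (by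
      simp only [Nat.factorial_succ]; push_cast; ring)
  have h2 (n w l s : ℕ) : (√((w + 1 : ℝ) / (n + 1 : ℝ)) : ℂ) * weight (n + 1) w l s =
      weight n (w + 1) l s :=
    sqrt_div_mul_weight (by positivity) (by positivity) (by
      simp only [Nat.factorial_succ]; push_cast; ring)
  have h3 (n w l s : ℕ) : (√((s + 1 : ℝ) / (l + 1 : ℝ)) : ℂ) * weight n w (l + 1) s =
      weight n w l (s + 1) :=
    sqrt_div_mul_weight (by positivity) (by positivity) (by
      simp only [Nat.factorial_succ]; push_cast; ring)
  have h4 (n w l s : ℕ) : (√((w + 1 : ℝ) / (s + 1 : ℝ)) : ℂ) * weight n w l (s + 1) =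
      weight n (w + 1) l s :=
    sqrt_div_mul_weight (by positivity) (by positivity) (by
      simp only [Nat.factorial_succ]; push_cast; ring)
  have e1 : scale (chargeVectorC Φ) = creC fun k => annL k (scale Φ) := by
    funext n w l s μ x
    rcases l with _ | l
    · simp [scale_apply, chargeVectorC, creC_zero]
    · simp only [scale_apply, chargeVectorC, creC_succ, annL_apply, Finset.mul_sum, ← h1]
      exact Finset.sum_congr rfl fun i _ => Finset.sum_congr rfl fun ν _ => by ring
  have e2 : scale (chargeVectorB Φ) = -creL fun k => annB k (scale Φ) := by
    funext n w l s μ x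
    rcases n with _ | n
    · simp [scale_apply, chargeVectorB, creL_zero]
    · simp only [scale_apply, chargeVectorB, creL_succ, annB_apply, Finset.mul_sum, ← h2,
        Pi.neg_apply, ← Finset.sum_neg_distrib]
      exact Finset.sum_congr rfl fun i _ => by ring
  have e3 : scale (chargeScalarC Φ) = (Complex.I * m) • creC fun k => annS k (scale Φ) := by
    funext n w l s μ x
    rcases l with _ | l
    · simp [scale_apply, chargeScalarC, creC_zero]
    · simp only [scale_apply, chargeScalarC, creC_succ, annS_apply, Finset.mul_sum, ← h3,
        Pi.smul_apply, smul_eq_mul]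
      exact Finset.sum_congr rfl fun i _ => by ring
  have e4 : scale (chargeScalarB Φ) = -(Complex.I * m) • creS fun k => annB k (scale Φ) := by
    funext n w l s μ x
    rcases s with _ | s
    · simp [scale_apply, chargeScalarB, creS_zero]
    · simp only [scale_apply, chargeScalarB, creS_succ, annB_apply, Finset.mul_sum, ← h4,
        Pi.smul_apply, smul_eq_mul]
      exact Finset.sum_congr rfl fun i _ => by ring
  simp only [chargeFamily, map_add, e1, e2, e3, e4, rawCharge, creE_apply, annD_apply, creC_add,
    creC_smul]
  module

/-! ### The number operator -/

/-- The operator that counts the ghosts and the longitudinal vector Bosons. -/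
def numberFamily (Φ : Family m) : Family m := fun n w l s μ x =>
  ((w + l + s : ℕ) : ℂ) * Φ n w l s μ x + ∑ i : Fin n, longitudinal Φ n w l s {i} μ x

theorem vecCons_comp_succAbove {α : Type*} {n : ℕ} (f : Fin (n + 1) → α) (i : Fin (n + 1)) :
    Matrix.vecCons (f i) (f ∘ i.succAbove) = f ∘ i.cycleRange.symm := by
  funext j
  refine Fin.cases ?_ (fun j => ?_) j
  · simp
  · simp

/-- The permutation `i.cycleRange.symm` brings entry i to the front and keeps the order of the
others. Its sign (-1)^i appears in the Fermionic analogues below. -/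
theorem IsSymm.vecCons_bosons {Φ : Family m} (hΦ : IsSymm Φ) {n w l s : ℕ} (i : Fin (n + 1))
    (ν : Fin 4) (μ : Fin (n + 1) → Fin 4) (x : Conf m (n + 1) w l s) :
    Φ (n + 1) w l s (Matrix.vecCons ν (μ ∘ i.succAbove))
      (Matrix.vecCons (x.1 i) (x.1 ∘ i.succAbove), x.2) =
      Φ (n + 1) w l s (Function.update μ i ν) x := by
  have h := hΦ (n + 1) w l s i.cycleRange.symm 1 1 1 (Function.update μ i ν) x
  have hμ : Function.update μ i ν ∘ i.cycleRange.symm = Matrix.vecCons ν (μ ∘ i.succAbove) := by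
    rw [← vecCons_comp_succAbove, Function.update_self]
    congr 1
    funext j
    simp
  rw [hμ] at h
  rw [vecCons_comp_succAbove]
  simpa using h

theorem IsSymm.vecCons_ghostB {Φ : Family m} (hΦ : IsSymm Φ) {n w l s : ℕ} (i : Fin (w + 1))
    (μ : Fin n → Fin 4) (x : Conf m n (w + 1) l s) :
    Φ n (w + 1) l s μ (x.1, Matrix.vecCons (x.2.1 i) (x.2.1 ∘ i.succAbove), x.2.2) =
      (-1) ^ (i : ℕ) * Φ n (w + 1) l s μ x := by
  have h := hΦ n (w + 1) l s 1 i.cycleRange.symm 1 1 μ x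
  rw [vecCons_comp_succAbove]
  simpa [Equiv.Perm.sign_symm, Fin.sign_cycleRange] using h

theorem IsSymm.vecCons_ghostC {Φ : Family m} (hΦ : IsSymm Φ) {n w l s : ℕ} (i : Fin (l + 1))
    (μ : Fin n → Fin 4) (x : Conf m n w (l + 1) s) :
    Φ n w (l + 1) s μ
      (x.1, x.2.1, Matrix.vecCons (x.2.2.1 i) (x.2.2.1 ∘ i.succAbove), x.2.2.2) =
      (-1) ^ (i : ℕ) * Φ n w (l + 1) s μ x := by
  have h := hΦ n w (l + 1) s 1 1 i.cycleRange.symm 1 μ x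
  rw [vecCons_comp_succAbove]
  simpa [Equiv.Perm.sign_symm, Fin.sign_cycleRange] using h

theorem IsSymm.vecCons_ghostS {Φ : Family m} (hΦ : IsSymm Φ) {n w l s : ℕ} (i : Fin (s + 1))
    (μ : Fin n → Fin 4) (x : Conf m n w l (s + 1)) :
    Φ n w l (s + 1) μ
      (x.1, x.2.1, x.2.2.1, Matrix.vecCons (x.2.2.2 i) (x.2.2.2 ∘ i.succAbove)) =
      Φ n w l (s + 1) μ x := by
  have h := hΦ n w l (s + 1) 1 1 1 i.cycleRange.symm μ x
  rw [vecCons_comp_succAbove]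
  simpa using h

/-- The Kronecker factors leave only multi-indices that agree with `μ` away from `i`. -/
theorem longitudinal_singleton (Φ : Family m) (n w l s : ℕ) (i : Fin n) (μ : Fin n → Fin 4)
    (x : Conf m n w l s) :
    longitudinal Φ n w l s {i} μ x = ∑ ν, lower (x.1 i) (μ i) * upper (x.1 i) ν / (m : ℂ) ^ 2 *
      Φ n w l s (Function.update μ i ν) x := by
  symm
  refine Finset.sum_of_injOn (fun ν => Function.update μ i ν)
    (fun a _ b _ h => Function.update_injective μ i h) (fun _ _ => Finset.mem_univ _) ?_ ?_
  · intro ν _ hν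
    have : ∃ j, j ≠ i ∧ μ j ≠ ν j := by
      by_contra! h
      refine hν ⟨ν i, by simp, ?_⟩
      funext j
      rcases eq_or_ne j i with rfl | hj
      · simp
      · simp [hj, h j hj]
    obtain ⟨j, hj, hne⟩ := this
    rw [Finset.prod_eq_zero (Finset.mem_univ j) (by simp [hj, hne]), zero_mul]
  · intro ν _
    rw [Finset.prod_eq_single i (fun j _ hj => by simp [hj]) (by simp)]
    simp

/-- Annihilating and recreating a particle at place i restores `Φ`, since the sign of the cycle
cancels the sign in the creation operator. Each kind of ghost thus contributes its number of
particles, and each vector variable contributes its longitudinal projector. -/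
theorem rawNumber_eq {Φ : Family m} (hΦ : IsSymm Φ) : rawNumber Φ = numberFamily Φ := by
  have hL : ((m : ℂ) ^ 2)⁻¹ • creL (fun k => annL k Φ) =
      fun n w l s μ x => ∑ i : Fin n, longitudinal Φ n w l s {i} μ x := by
    funext n w l s μ x
    rcases n with _ | n
    · simp [creL_zero]
    · simp only [Pi.smul_apply, smul_eq_mul, creL_succ, annL_apply, hΦ.vecCons_bosons,
        longitudinal_singleton, Finset.mul_sum]
      exact Finset.sum_congr rfl fun i _ => Finset.sum_congr rfl fun ν _ => by ring
  have hB : creB (fun k => annB k Φ) = fun (n w l s : ℕ) μ x => (w : ℂ) * Φ n w l s μ x := by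
    funext n w l s μ x
    rcases w with _ | w
    · simp [creB_zero]
    · simp [creB_succ, annB_apply, hΦ.vecCons_ghostB, ← mul_assoc, ← mul_pow]
  have hC : creC (fun k => annC k Φ) = fun (n w l s : ℕ) μ x => (l : ℂ) * Φ n w l s μ x := by
    funext n w l s μ x
    rcases l with _ | l
    · simp [creC_zero]
    · have h : ((-1 : ℂ) ^ w) * (-1) ^ w = 1 := by rw [← mul_pow]; simp
      have h' (i : ℕ) (z : ℂ) : (-1 : ℂ) ^ i * ((-1) ^ w * ((-1) ^ i * z)) = (-1) ^ w * z := by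
        have : ((-1 : ℂ) ^ i) * (-1) ^ i = 1 := by rw [← mul_pow]; simp
        linear_combination (-1) ^ w * z * this
      simp only [creC_succ, annC_apply, hΦ.vecCons_ghostC, h', Finset.sum_const, Finset.card_univ,
        Fintype.card_fin, nsmul_eq_mul]
      linear_combination ((l + 1 : ℕ) : ℂ) * Φ n w (l + 1) s μ x * h
  have hS : creS (fun k => annS k Φ) = fun (n w l s : ℕ) μ x => (s : ℂ) * Φ n w l s μ x := by
    funext n w l s μ x
    rcases s with _ | s
    · simp [creS_zero]
    · simp [creS_succ, annS_apply, hΦ.vecCons_ghostS]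
  rw [rawNumber, hL, hB, hC, hS]
  funext n w l s μ x
  simp only [Pi.add_apply, numberFamily]
  push_cast
  ring

/-! ### The homotopy -/

/-- The contracting homotopy of the supercharge. -/
def homotopyFamily (Φ : Family m) : Family m := unscale (rawHomotopy (scale Φ))

theorem chargeFamily_chargeFamily {Φ : Family m} (hΦ : IsSymm Φ) :
    chargeFamily (chargeFamily Φ) = 0 := by
  rw [← unscale_scale (chargeFamily (chargeFamily Φ)), scale_chargeFamily, scale_chargeFamily,
    rawCharge_rawCharge hΦ.scale, map_zero]

theorem numberFamily_scale (Φ : Family m) : numberFamily (scale Φ) = scale (numberFamily Φ) := by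
  funext n w l s μ x
  simp only [numberFamily, scale_apply, longitudinal, mul_add, Finset.mul_sum]
  congr 1
  · ring
  · exact Finset.sum_congr rfl fun i _ => Finset.sum_congr rfl fun ν _ => by ring

theorem chargeFamily_homotopyFamily_add (hm : m ≠ 0) {Φ : Family m} (hΦ : IsSymm Φ) :
    chargeFamily (homotopyFamily Φ) + homotopyFamily (chargeFamily Φ) = numberFamily Φ := by
  rw [← unscale_scale (chargeFamily (homotopyFamily Φ)), scale_chargeFamily, homotopyFamily,
    homotopyFamily, scale_unscale, scale_chargeFamily, ← map_add,
    rawCharge_rawHomotopy_add hm hΦ.scale, rawNumber_eq hΦ.scale, numberFamily_scale,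
    unscale_scale]

/-! ### Permutation symmetry -/

theorem exists_perm_comp_succAbove {n : ℕ} (π : Equiv.Perm (Fin (n + 1))) (i : Fin (n + 1)) :
    ∃ σ : Equiv.Perm (Fin n), π ∘ i.succAbove = (π i).succAbove ∘ σ ∧
      ((Equiv.Perm.sign σ : ℤ) : ℂ) =
        (-1) ^ (i : ℕ) * (-1) ^ (π i : ℕ) * ((Equiv.Perm.sign π : ℤ) : ℂ) := by
  -- Composing with the cycles that bring i and π i to the front gives a permutation fixing 0; σ is
  -- its restriction to the remaining entries.
  set ρ : Equiv.Perm (Fin (n + 1)) := (π i).cycleRange * π * i.cycleRange⁻¹ with hρ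
  obtain ⟨⟨p, σ⟩, hσ⟩ := Equiv.Perm.decomposeFin.symm.surjective ρ
  have hp : p = 0 := by
    rw [← Equiv.Perm.decomposeFin_symm_apply_zero p σ, hσ, hρ]
    simp [Equiv.Perm.inv_def]
  subst hp
  refine ⟨σ, ?_, ?_⟩
  · funext j
    have h : ρ j.succ = (σ j).succ := by
      rw [← hσ, Equiv.Perm.decomposeFin_symm_apply_succ]
      simp
    have h' : (π i).cycleRange (π (i.succAbove j)) = (σ j).succ := by
      rw [← h, hρ]
      simp [Equiv.Perm.inv_def]
    rw [Function.comp_apply, Function.comp_apply, ← Fin.cycleRange_symm_succ (π i), ← h',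
      Equiv.symm_apply_apply]
  · have h := congrArg Equiv.Perm.sign hσ
    rw [Equiv.Perm.decomposeFin.symm_sign, hρ] at h
    simp only [if_true, one_mul, map_mul, Equiv.Perm.sign_inv, Fin.sign_cycleRange] at h
    rw [h]
    push_cast
    ring

/-- A single τ must serve every entry type, because indices and momenta of vector Bosons are
permuted simultaneously. -/
theorem exists_perm_vecCons {n : ℕ} (σ : Equiv.Perm (Fin n)) :
    ∃ τ : Equiv.Perm (Fin (n + 1)), Equiv.Perm.sign τ = Equiv.Perm.sign σ ∧
      ∀ {α : Type} (a : α) (f : Fin n → α),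
        Matrix.vecCons a (f ∘ σ) = Matrix.vecCons a f ∘ τ := by
  refine ⟨Equiv.Perm.decomposeFin.symm (0, σ), by simp, fun a f => ?_⟩
  funext j
  refine Fin.cases ?_ (fun j => ?_) j
  · simp
  · simp

theorem IsSymm.sub {Φ Ψ : Family m} (hΦ : IsSymm Φ) (hΨ : IsSymm Ψ) : IsSymm (Φ - Ψ) := by
  intro n w l s π σ τ θ μ x
  simp only [Pi.sub_apply, hΦ n w l s π σ τ θ μ x, hΨ n w l s π σ τ θ μ x, mul_sub]

theorem IsSymm.smul {Φ : Family m} (hΦ : IsSymm Φ) (c : ℂ) : IsSymm (c • Φ) := by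
  intro n w l s π σ τ θ μ x
  simp only [Pi.smul_apply, smul_eq_mul, hΦ n w l s π σ τ θ μ x]
  ring

theorem IsSymm.unscale {Φ : Family m} (hΦ : IsSymm Φ) : IsSymm (unscale Φ) := by
  intro n w l s π σ τ θ μ x
  rw [unscale_apply, unscale_apply, hΦ n w l s π σ τ θ μ x]
  ring

theorem IsSymm.creS_annC {Φ : Family m} (hΦ : IsSymm Φ) : IsSymm (creS fun k => annC k Φ) := by
  intro n w l s π σ τ θ μ x
  rcases s with _ | s
  · simp [creS_zero]
  simp only [creS_succ, annC_apply, Finset.mul_sum]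
  refine (Fintype.sum_equiv θ _ _ fun i => ?_)
  obtain ⟨θ', hθ, -⟩ := exists_perm_comp_succAbove θ i
  obtain ⟨τ', hτ, hτ'⟩ := exists_perm_vecCons τ
  rw [Function.comp_assoc, hθ, ← Function.comp_assoc, hτ', Function.comp_apply]
  have h := hΦ n w (l + 1) s π σ τ' θ' μ (x.1, x.2.1,
    Matrix.vecCons (x.2.2.2 (θ i)) x.2.2.1, x.2.2.2 ∘ (θ i).succAbove)
  simp only [hτ] at h
  rw [h]
  ring

/-- The permutation induced on the remaining ghosts has sign (-1)^(i + σ i) sign σ, and the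
alternating signs of `creB` absorb the first factor when the sum is reindexed by σ. -/
theorem IsSymm.creB_annL {Φ : Family m} (hΦ : IsSymm Φ) : IsSymm (creB fun k => annL k Φ) := by
  intro n w l s π σ τ θ μ x
  rcases w with _ | w
  · simp [creB_zero]
  simp only [creB_succ, annL_apply, Finset.mul_sum]
  refine (Fintype.sum_equiv σ _ _ fun i => Finset.sum_congr rfl fun ν _ => ?_)
  obtain ⟨σ', hσ, hs⟩ := exists_perm_comp_succAbove σ i
  obtain ⟨π', -, hπ'⟩ := exists_perm_vecCons π
  rw [Function.comp_assoc, hσ, ← Function.comp_assoc, hπ', hπ', Function.comp_apply]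
  have h := hΦ (n + 1) w l s π' σ' τ θ (Matrix.vecCons ν μ)
    (Matrix.vecCons (x.2.1 (σ i)) x.1, x.2.1 ∘ (σ i).succAbove, x.2.2)
  simp only [hs] at h
  rw [h]
  have e : ((-1 : ℂ) ^ (i : ℕ)) * (-1) ^ (i : ℕ) = 1 := by rw [← mul_pow]; simp
  linear_combination (upper (x.2.1 (σ i)) ν * (-1) ^ (σ i : ℕ) *
    ((Equiv.Perm.sign σ : ℤ) : ℂ) * ((Equiv.Perm.sign τ : ℤ) : ℂ) *
    Φ (n + 1) w l s (Matrix.vecCons ν μ)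
      (Matrix.vecCons (x.2.1 (σ i)) x.1, x.2.1 ∘ (σ i).succAbove, x.2.2)) * e

theorem IsSymm.homotopyFamily {Φ : Family m} (hΦ : IsSymm Φ) : IsSymm (homotopyFamily Φ) :=
  ((hΦ.scale.creS_annC.smul _).sub (hΦ.scale.creB_annL.smul _)).unscale

theorem IsSymm.numberFamily {Φ : Family m} (hΦ : IsSymm Φ) : IsSymm (numberFamily Φ) := by
  intro n w l s π σ τ θ μ x
  simp only [SpinOneBoson.numberFamily, hΦ n w l s π σ τ θ μ x, mul_add, Finset.mul_sum]
  congr 1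
  · ring
  refine Fintype.sum_equiv π _ _ fun i => ?_
  simp only [longitudinal_singleton, Finset.mul_sum]
  refine Finset.sum_congr rfl fun ν _ => ?_
  have e : Function.update (μ ∘ π) i ν = Function.update μ (π i) ν ∘ π :=
    (Function.update_comp_eq_of_injective _ π.injective _ _).symm
  rw [e, hΦ n w l s π σ τ θ]
  simp only [Function.comp_apply]
  ring

/-! ### Measurability -/

/-- The homotopy evaluates families at configurations in which one variable has changed its kind.
Preservation of measure transfers measurability, null sets and square integrability. -/
theorem measurePreserving_ghostS (m : ℝ) (n w l s : ℕ) (i : Fin (s + 1)) :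
    MeasurePreserving
      (fun x : Conf m n w l (s + 1) =>
        ((x.1, x.2.1, Matrix.vecCons (x.2.2.2 i) x.2.2.1, x.2.2.2 ∘ i.succAbove) :
          Conf m n w (l + 1) s))
      (confMeasure m n w l (s + 1)) (confMeasure m n w (l + 1) s) :=
  (MeasurePreserving.id _).prod ((MeasurePreserving.id _).prod
    ((Measure.measurePreserving_swap (μ := prodMeasure m s)
      (ν := prodMeasure m (l + 1))).comp ((measurePreserving_transfer m s l i).comp
        (Measure.measurePreserving_swap (μ := prodMeasure m l) (ν := prodMeasure m (s + 1))))))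

theorem measurePreserving_ghostB (m : ℝ) (n w l s : ℕ) (i : Fin (w + 1)) :
    MeasurePreserving
      (fun x : Conf m n (w + 1) l s =>
        ((Matrix.vecCons (x.2.1 i) x.1, x.2.1 ∘ i.succAbove, x.2.2) : Conf m (n + 1) w l s))
      (confMeasure m n (w + 1) l s) (confMeasure m (n + 1) w l s) :=
  ((measurePreserving_prodAssoc _ _ _).comp
    (((Measure.measurePreserving_swap (μ := prodMeasure m w)
      (ν := prodMeasure m (n + 1))).comp ((measurePreserving_transfer m w n i).comp
        (Measure.measurePreserving_swap (μ := prodMeasure m n)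
          (ν := prodMeasure m (w + 1))))).prod (MeasurePreserving.id _))).comp
    (measurePreserving_prodAssoc _ _ _).symm

theorem scale_borel {Φ : Family m} (hΦ : Φ ∈ borel m) : scale Φ ∈ borel m :=
  fun n w l s μ => (hΦ n w l s μ).const_mul _

theorem creS_annC_borel {Φ : Family m} (hΦ : Φ ∈ borel m) :
    creS (fun k => annC k Φ) ∈ borel m := by
  intro n w l s μ
  rcases s with _ | s
  · rw [creS_zero]
    exact measurable_const
  · rw [funext (f := creS (fun k => annC k Φ) n w l (s + 1) μ) fun x =>
      creS_succ (fun k => annC k Φ) n w l s μ x]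
    exact Finset.measurable_fun_sum _ fun i _ =>
      ((hΦ _ _ _ _ _).comp (measurePreserving_ghostS m n w l s i).measurable).const_mul _

theorem creB_annL_borel {Φ : Family m} (hΦ : Φ ∈ borel m) :
    creB (fun k => annL k Φ) ∈ borel m := by
  intro n w l s μ
  rcases w with _ | w
  · rw [creB_zero]
    exact measurable_const
  · rw [funext (f := creB (fun k => annL k Φ) n (w + 1) l s μ) fun x =>
      creB_succ (fun k => annL k Φ) n w l s μ x]
    refine Finset.measurable_fun_sum _ fun i _ =>
      (Finset.measurable_fun_sum _ fun ν _ => Measurable.mul ?_ ?_).const_mul _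
    · exact (measurable_upper ν).comp (by fun_prop)
    · exact (hΦ _ _ _ _ _).comp (measurePreserving_ghostB m n w l s i).measurable

theorem homotopyFamily_borel {Φ : Family m} (hΦ : Φ ∈ borel m) : homotopyFamily Φ ∈ borel m :=
  fun n w l s μ => ((((creS_annC_borel (scale_borel hΦ) n w l s μ).const_mul _).sub
    ((creB_annL_borel (scale_borel hΦ) n w l s μ).const_mul _))).const_mul _

theorem numberFamily_borel {Φ : Family m} (hΦ : Φ ∈ borel m) : numberFamily Φ ∈ borel m :=
  fun n w l s μ => ((hΦ n w l s μ).const_mul _).add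
    (Finset.measurable_fun_sum _ fun i _ => measurable_longitudinal hΦ n w l s {i} μ)

/-- The contracting homotopy on families of Borel functions. -/
def homotopyBorel (m : ℝ) : borel m →ₗ[ℂ] borel m where
  toFun Φ := ⟨homotopyFamily Φ.1, homotopyFamily_borel Φ.2⟩
  map_add' a b := by
    apply Subtype.ext
    simp only [homotopyFamily, rawHomotopy, Submodule.coe_add, map_add, creS_add, creB_add,
      smul_add, map_sub]
    abel
  map_smul' c a := by
    apply Subtype.ext
    simp only [homotopyFamily, rawHomotopy, Submodule.coe_smul, map_smul, creS_smul, creB_smul,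
      map_sub, RingHom.id_apply, smul_sub, smul_comm _ c]

/-- The number operator on families of Borel functions. -/
def numberBorel (m : ℝ) : borel m →ₗ[ℂ] borel m where
  toFun Φ := ⟨numberFamily Φ.1, numberFamily_borel Φ.2⟩
  map_add' a b := by
    apply Subtype.ext
    funext n w l s μ x
    simp only [numberFamily, Submodule.coe_add, longitudinal_add, Pi.add_apply, mul_add,
      Finset.sum_add_distrib]
    ring
  map_smul' c a := by
    apply Subtype.ext
    funext n w l s μ x
    simp only [numberFamily, Submodule.coe_smul, longitudinal_smul, Pi.smul_apply, smul_eq_mul,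
      ← Finset.mul_sum, RingHom.id_apply]
    ring

theorem homotopyFamily_apply (Φ : Family m) (n w l s : ℕ) (μ : Fin n → Fin 4)
    (x : Conf m n w l s) : homotopyFamily Φ n w l s μ x = (weight n w l s)⁻¹ *
      ((Complex.I * m)⁻¹ * creS (fun k => annC k (scale Φ)) n w l s μ x -
        ((m : ℂ) ^ 2)⁻¹ * creB (fun k => annL k (scale Φ)) n w l s μ x) := rfl

/-- Used both for the passage of H to classes and for the vanishing of H on transversal states
without ghosts. The hypotheses concern exactly the source components of the two parts of H. -/
theorem homotopyFamily_ae_eq_zero {Φ : Family m} {n w l s : ℕ} {μ : Fin n → Fin 4}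
    (hC : ∀ r, s = r + 1 → Φ n w (l + 1) r μ =ᵐ[confMeasure m n w (l + 1) r] 0)
    (hL : ∀ r, w = r + 1 → ∀ᵐ x ∂confMeasure m (n + 1) r l s,
      ∑ ν, upper (x.1 0) ν * Φ (n + 1) r l s (Matrix.vecCons ν μ) x = 0) :
    homotopyFamily Φ n w l s μ =ᵐ[confMeasure m n w l s] 0 := by
  have h1 : creS (fun k => annC k (scale Φ)) n w l s μ =ᵐ[confMeasure m n w l s] 0 := by
    rcases s with _ | s
    · rw [creS_zero]
      rfl
    · have : ∀ i : Fin (s + 1), _ := fun i =>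
        (measurePreserving_ghostS m n w l s i).quasiMeasurePreserving.ae (hC s rfl)
      filter_upwards [ae_all_iff.2 this] with x hx
      simp only [Pi.zero_apply] at hx
      simp [creS_succ, annC_apply, scale_apply, hx]
  have h2 : creB (fun k => annL k (scale Φ)) n w l s μ =ᵐ[confMeasure m n w l s] 0 := by
    rcases w with _ | w
    · rw [creB_zero]
      rfl
    · have : ∀ i : Fin (w + 1), _ := fun i =>
        (measurePreserving_ghostB m n w l s i).quasiMeasurePreserving.ae (hL w rfl)
      filter_upwards [ae_all_iff.2 this] with x hx
      simp only [Matrix.cons_val_zero] at hx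
      simp [creB_succ, annL_apply, scale_apply, mul_left_comm _ (weight _ _ _ _),
        ← Finset.mul_sum, hx]
  filter_upwards [h1, h2] with x e1 e2
  simp [homotopyFamily_apply, e1, e2]

theorem homotopyBorel_null (m : ℝ) : null m ≤ (null m).comap (homotopyBorel m) := by
  intro Φ hΦ n w l s μ
  refine homotopyFamily_ae_eq_zero (fun r _ => hΦ n w (l + 1) r μ) fun r _ => ?_
  filter_upwards [ae_all_iff.2 fun ν => hΦ (n + 1) r l s (Matrix.vecCons ν μ)] with x hx
  simp [hx]

theorem numberBorel_null (m : ℝ) : null m ≤ (null m).comap (numberBorel m) := by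
  intro Φ hΦ n w l s μ
  filter_upwards [ae_all_iff.2 fun ν => hΦ n w l s ν] with x hx
  have : numberFamily Φ.1 n w l s μ x = 0 := by
    simp [numberFamily, longitudinal, hx]
  exact this

/-- The contracting homotopy on classes of families. -/
def homotopy (m : ℝ) : Wave m →ₗ[ℂ] Wave m :=
  (null m).mapQ (null m) (homotopyBorel m) (homotopyBorel_null m)

/-- The number operator on classes of families. -/
def number (m : ℝ) : Wave m →ₗ[ℂ] Wave m :=
  (null m).mapQ (null m) (numberBorel m) (numberBorel_null m)

/-! ### Square integrability of the longitudinal parts -/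

theorem memLp_two_iff_lintegral {α : Type*} [MeasurableSpace α] {ν : Measure α} {f : α → ℂ}
    (hf : Measurable f) : MemLp f 2 ν ↔ ∫⁻ x, ‖f x‖ₑ ^ 2 ∂ν < ⊤ := by
  have h := eLpNorm_lt_top_iff_lintegral_rpow_enorm_lt_top (μ := ν) (f := f) (p := 2) (by norm_num)
    (by norm_num)
  simp only [ENNReal.toReal_ofNat, ENNReal.rpow_ofNat] at h
  exact ⟨fun H => h.1 H.2, fun H => ⟨hf.aestronglyMeasurable, h.2 H⟩⟩

theorem tsum_lt_top_of_eventually_zero {f : ℕ → ENNReal} (N : ℕ) (h0 : ∀ n, N < n → f n = 0)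
    (hf : ∀ n, f n < ⊤) : ∑' n, f n < ⊤ := by
  rw [tsum_eq_sum (s := Finset.range (N + 1)) fun n hn => h0 n (by simpa using hn)]
  exact ENNReal.sum_lt_top.2 fun n _ => hf n

theorem normSq_lt_top {Φ : Family m} (N : ℕ)
    (hN : ∀ n w l s, N < n + w + l + s → Φ n w l s = 0)
    (hΦ : ∀ n w l s μ, ∫⁻ x, ‖Φ n w l s μ x‖ₑ ^ 2 ∂confMeasure m n w l s < ⊤) :
    normSq Φ < ⊤ := by
  have h0 (n w l s : ℕ) (h : N < n + w + l + s) :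
      ∑ μ : Fin n → Fin 4, ∫⁻ x, ‖Φ n w l s μ x‖ₑ ^ 2 ∂confMeasure m n w l s = 0 := by
    simp [hN n w l s h]
  refine tsum_lt_top_of_eventually_zero N (fun n hn => ?_) fun n =>
    tsum_lt_top_of_eventually_zero N (fun w hw => ?_) fun w =>
    tsum_lt_top_of_eventually_zero N (fun l hl => ?_) fun l =>
    tsum_lt_top_of_eventually_zero N (fun s hs => h0 n w l s (by omega)) fun s =>
    ENNReal.sum_lt_top.2 fun μ _ => hΦ n w l s μ
  · simp only [fun w l s => h0 n w l s (by omega), tsum_zero]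
  · simp only [fun l s => h0 n w l s (by omega), tsum_zero]
  · simp only [fun s => h0 n w l s (by omega), tsum_zero]

/-! ### Algebra of the longitudinal projectors and stability of the finite-particle space -/

/-- The longitudinal projector in the variables `kᵢ`, `i ∈ S`, at a fixed configuration. -/
def longOp {n : ℕ} (K : Fin n → Shell m) (S : Finset (Fin n)) :
    Module.End ℂ ((Fin n → Fin 4) → ℂ) where
  toFun v := fun μ => ∑ ν : Fin n → Fin 4,
    (∏ i, if i ∈ S then lower (K i) (μ i) * upper (K i) (ν i) / (m : ℂ) ^ 2
      else if μ i = ν i then 1 else 0) * v ν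
  map_add' u v := by
    funext μ
    simp only [Pi.add_apply, mul_add, Finset.sum_add_distrib]
  map_smul' c v := by
    funext μ
    simp only [Pi.smul_apply, smul_eq_mul, mul_left_comm _ c, ← Finset.mul_sum, RingHom.id_apply]

theorem longitudinal_eq (Φ : Family m) (n w l s : ℕ) (S : Finset (Fin n)) (μ : Fin n → Fin 4)
    (x : Conf m n w l s) :
    longitudinal Φ n w l s S μ x = longOp x.1 S (fun ν => Φ n w l s ν x) μ := rfl

theorem longOp_empty {n : ℕ} (K : Fin n → Shell m) : longOp K ∅ = 1 := by
  refine LinearMap.ext fun v => funext fun μ => ?_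
  have : (longOp K ∅ v μ) = ∑ ν : Fin n → Fin 4, (if μ = ν then 1 else 0) * v ν := by
    refine Finset.sum_congr rfl fun ν _ => ?_
    congr 1
    simp [Finset.prod_ite_zero, funext_iff]
  rw [this]
  simp

/-- Projectors in distinct variables act on distinct tensor factors, and in one variable idempotency
is k^ν k_ν = m². -/
theorem longOp_mul (hm : m ≠ 0) {n : ℕ} (K : Fin n → Shell m) (S T : Finset (Fin n)) :
    longOp K S * longOp K T = longOp K (S ∪ T) := by
  have hc : (m : ℂ) ≠ 0 := by exact_mod_cast hm
  refine LinearMap.ext fun v => funext fun μ => ?_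
  simp only [Module.End.mul_apply]
  simp only [longOp, LinearMap.coe_mk, AddHom.coe_mk, Finset.mul_sum, ← mul_assoc,
    ← Finset.prod_mul_distrib]
  rw [Finset.sum_comm]
  refine Finset.sum_congr rfl fun ρ _ => ?_
  rw [← Finset.sum_mul]
  congr 1
  -- The sum over the intermediate multi-index factors into one-variable sums.
  rw [← Fintype.piFinset_univ, ← Finset.prod_univ_sum (fun _ => Finset.univ) fun i b =>
    (if i ∈ S then lower (K i) (μ i) * upper (K i) b / (m : ℂ) ^ 2
      else if μ i = b then 1 else 0) *
    (if i ∈ T then lower (K i) b * upper (K i) (ρ i) / (m : ℂ) ^ 2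
      else if b = ρ i then 1 else 0)]
  refine Finset.prod_congr rfl fun i _ => ?_
  by_cases hS : i ∈ S <;> by_cases hT : i ∈ T <;> simp [hS, hT]
  have h (b : Fin 4) : lower (K i) (μ i) * upper (K i) b / (m : ℂ) ^ 2 *
      (lower (K i) b * upper (K i) (ρ i) / (m : ℂ) ^ 2) =
      lower (K i) (μ i) * upper (K i) (ρ i) / (m : ℂ) ^ 4 * (upper (K i) b * lower (K i) b) := by
    ring
  simp only [h, ← Finset.mul_sum, sum_upper_mul_lower]
  field_simp

theorem longitudinal_empty (Φ : Family m) (n w l s : ℕ) (μ : Fin n → Fin 4) :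
    longitudinal Φ n w l s ∅ μ = Φ n w l s μ := by
  funext x
  rw [longitudinal_eq, longOp_empty]
  rfl

/-- N enlarges the set of projected variables by one. Requiring integrability for all sets `S` in 𝓓₀
makes that space stable under N. -/
theorem longitudinal_numberFamily (hm : m ≠ 0) (Φ : Family m) (n w l s : ℕ) (S : Finset (Fin n))
    (μ : Fin n → Fin 4) (x : Conf m n w l s) :
    longitudinal (numberFamily Φ) n w l s S μ x =
      ((w + l + s : ℕ) : ℂ) * longitudinal Φ n w l s S μ x +
        ∑ i, longitudinal Φ n w l s (S ∪ {i}) μ x := by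
  have h : (fun ν => numberFamily Φ n w l s ν x) =
      ((w + l + s : ℕ) : ℂ) • (fun ν => Φ n w l s ν x) +
        ∑ i, longOp x.1 {i} fun ν => Φ n w l s ν x := by
    funext ν
    simp [numberFamily, longitudinal_eq]
  simp only [longitudinal_eq, h, map_add, map_smul, map_sum, Pi.add_apply, Finset.sum_apply,
    Pi.smul_apply, smul_eq_mul, ← longOp_mul hm, Module.End.mul_apply]

/-- Projecting the annihilated variable as well expresses the contraction with k^ν through a
longitudinal part of `Φ`, up to the factor k_ν / m². -/
theorem longitudinal_vecCons (Φ : Family m) (n w l s : ℕ) (S : Finset (Fin n)) (k : Shell m)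
    (ν : Fin 4) (μ : Fin n → Fin 4) (x : Conf m n w l s) :
    longitudinal Φ (n + 1) w l s (insert 0 (S.map (Fin.succEmb n))) (Matrix.vecCons ν μ)
      (Matrix.vecCons k x.1, x.2) =
      lower k ν / (m : ℂ) ^ 2 * longitudinal (annL k Φ) n w l s S μ x := by
  simp only [longitudinal, annL_apply, Finset.mul_sum]
  rw [← (Fin.consEquiv fun _ => Fin 4).sum_comp, Fintype.sum_prod_type, Finset.sum_comm]
  refine Finset.sum_congr rfl fun ρ _ => Finset.sum_congr rfl fun a _ => ?_
  simp [Fin.prod_univ_succ, Fin.consEquiv, Matrix.vecCons]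
  ring

theorem mass_le_energy (hm : 0 < m) (k : Shell m) : m ≤ k.1 0 := by
  have h := k.2.1
  simp only [minkowski, Fin.sum_univ_three] at h
  have h0 := k.2.2
  nlinarith [sq_nonneg (k.1 (Fin.succ 0)), sq_nonneg (k.1 (Fin.succ 1)),
    sq_nonneg (k.1 (Fin.succ 2))]

theorem memLp_longitudinal_creS_annC {Φ : Family m}
    (hΦ : ∀ n w l s S μ, MemLp (longitudinal Φ n w l s S μ) 2 (confMeasure m n w l s))
    (n w l s : ℕ) (S : Finset (Fin n)) (μ : Fin n → Fin 4) :
    MemLp (longitudinal (creS fun k => annC k Φ) n w l s S μ) 2 (confMeasure m n w l s) := by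
  rcases s with _ | s
  · have : longitudinal (creS fun k => annC k Φ) n w l 0 S μ = 0 := by
      funext x
      simp [longitudinal, creS_zero]
    rw [this]
    exact MemLp.zero
  · have : longitudinal (creS fun k => annC k Φ) n w l (s + 1) S μ = fun x => ∑ i : Fin (s + 1),
        (-1) ^ w * longitudinal Φ n w (l + 1) s S μ
          (x.1, x.2.1, Matrix.vecCons (x.2.2.2 i) x.2.2.1, x.2.2.2 ∘ i.succAbove) := by
      funext x
      simp only [longitudinal, creS_succ, annC_apply, Finset.mul_sum]
      rw [Finset.sum_comm]
      exact Finset.sum_congr rfl fun i _ => Finset.sum_congr rfl fun ν _ => by ring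
    rw [this]
    exact memLp_finsetSum _ fun i _ => ((hΦ n w (l + 1) s S μ).comp_measurePreserving
      (measurePreserving_ghostS m n w l s i)).const_mul _

/-- Contraction with the unbounded k^ν is harmless on 𝓓₀: it equals m²/k₀ times the component with
index 0 of the longitudinal part, and 0 < m²/k₀ ≤ m. -/
theorem memLp_longitudinal_creB_annL (hm : 0 < m) {Φ : Family m}
    (hΦ : ∀ n w l s S μ, MemLp (longitudinal Φ n w l s S μ) 2 (confMeasure m n w l s))
    (n w l s : ℕ) (S : Finset (Fin n)) (μ : Fin n → Fin 4) :
    MemLp (longitudinal (creB fun k => annL k Φ) n w l s S μ) 2 (confMeasure m n w l s) := by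
  rcases w with _ | w
  · have : longitudinal (creB fun k => annL k Φ) n 0 l s S μ = 0 := by
      funext x
      simp [longitudinal, creB_zero]
    rw [this]
    exact MemLp.zero
  · have hc : (m : ℂ) ≠ 0 := by exact_mod_cast hm.ne'
    have h0 (k : Shell m) : lower k 0 ≠ 0 := by
      simpa [lower, upper] using (hm.trans_le (mass_le_energy hm k)).ne'
    -- The index 0 is chosen because k₀ never vanishes on the shell.
    have : longitudinal (creB fun k => annL k Φ) n (w + 1) l s S μ = fun x => ∑ i : Fin (w + 1),
        (-1) ^ (i : ℕ) * ((m : ℂ) ^ 2 / lower (x.2.1 i) 0 *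
          longitudinal Φ (n + 1) w l s (insert 0 (S.map (Fin.succEmb n))) (Matrix.vecCons 0 μ)
          (Matrix.vecCons (x.2.1 i) x.1, x.2.1 ∘ i.succAbove, x.2.2)) := by
      funext x
      have e (i : Fin (w + 1)) := longitudinal_vecCons Φ n w l s S (x.2.1 i) 0 μ
        (x.1, x.2.1 ∘ i.succAbove, x.2.2)
      simp only at e
      simp only [e, ← mul_assoc]
      have e' (i : Fin (w + 1)) : (-1) ^ (i : ℕ) * ((m : ℂ) ^ 2 / lower (x.2.1 i) 0) *
          (lower (x.2.1 i) 0 / (m : ℂ) ^ 2) = (-1) ^ (i : ℕ) := by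
        have := h0 (x.2.1 i)
        field_simp
      simp only [e', longitudinal, creB_succ, Finset.mul_sum]
      rw [Finset.sum_comm]
      exact Finset.sum_congr rfl fun i _ => Finset.sum_congr rfl fun ν _ => by ring
    rw [this]
    refine memLp_finsetSum _ fun i _ => MemLp.const_mul ?_ _
    have hF := (hΦ (n + 1) w l s (insert 0 (S.map (Fin.succEmb n))) (Matrix.vecCons 0 μ)
      ).comp_measurePreserving (measurePreserving_ghostB m n w l s i)
    refine hF.of_le_mul (c := m) (AEStronglyMeasurable.mul ?_ hF.1) (ae_of_all _ fun x => ?_)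
    · exact (Measurable.const_div ((measurable_lower 0).comp (by fun_prop)) _).aestronglyMeasurable
    · rw [norm_mul]
      refine mul_le_mul_of_nonneg_right ?_ (norm_nonneg _)
      have h1 := mass_le_energy hm (x.2.1 i)
      have h2 : ‖lower (x.2.1 i) 0‖ = (x.2.1 i).1 0 := by
        simp only [lower, upper, if_true, Complex.norm_real, Real.norm_eq_abs]
        exact abs_of_pos (hm.trans_le h1)
      rw [norm_div, norm_pow, Complex.norm_real, Real.norm_eq_abs, abs_of_pos hm, h2,
        div_le_iff₀ (hm.trans_le h1)]
      nlinarith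

/-- Finiteness of the norm is redundant: it is the case `S = ∅`, summed over finitely many
components. -/
theorem mem_finiteFamilies_iff {Φ : borel m} : Φ ∈ finiteFamilies m ↔ IsSymm Φ.1 ∧
    (∃ N : ℕ, ∀ n w l s, N < n + w + l + s → Φ.1 n w l s = 0) ∧
    ∀ n w l s S μ, MemLp (longitudinal Φ.1 n w l s S μ) 2 (confMeasure m n w l s) := by
  simp only [memLp_two_iff_lintegral (measurable_longitudinal Φ.2 _ _ _ _ _ _)]
  refine ⟨fun h => ⟨h.1.1, h.2⟩, fun h => ⟨⟨h.1, ?_⟩, h.2⟩⟩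
  obtain ⟨-, ⟨N, hN⟩, h⟩ := h
  refine normSq_lt_top N hN fun n w l s μ => ?_
  simpa only [longitudinal_empty] using h n w l s ∅ μ

theorem homotopyBorel_mem_finiteFamilies (hm : 0 < m) {Φ : borel m} (hΦ : Φ ∈ finiteFamilies m) :
    homotopyBorel m Φ ∈ finiteFamilies m := by
  obtain ⟨h1, ⟨N, hN⟩, h3⟩ := mem_finiteFamilies_iff.1 hΦ
  refine mem_finiteFamilies_iff.2 ⟨h1.homotopyFamily, ⟨N, fun n w l s h => ?_⟩,
    fun n w l s S μ => ?_⟩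
  · funext μ x
    have hS : creS (fun k => annC k (scale Φ.1)) n w l s μ x = 0 := by
      rcases s with _ | s
      · rw [creS_zero]
        rfl
      · simp [creS_succ, annC_apply, scale_apply, hN n w (l + 1) s (by omega)]
    have hB : creB (fun k => annL k (scale Φ.1)) n w l s μ x = 0 := by
      rcases w with _ | w
      · rw [creB_zero]
        rfl
      · simp [creB_succ, annL_apply, scale_apply, hN (n + 1) w l s (by omega)]
    have : homotopyFamily Φ.1 n w l s μ x = 0 := by
      rw [homotopyFamily_apply, hS, hB]
      simp
    exact this
  · have h4 (n w l s S μ) :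
        MemLp (longitudinal (scale Φ.1) n w l s S μ) 2 (confMeasure m n w l s) := by
      have : longitudinal (scale Φ.1) n w l s S μ =
          fun x => weight n w l s * longitudinal Φ.1 n w l s S μ x := by
        funext x
        simp only [longitudinal, scale_apply, Finset.mul_sum, mul_left_comm _ (weight n w l s)]
      rw [this]
      exact (h3 n w l s S μ).const_mul _
    have e : longitudinal (homotopyFamily Φ.1) n w l s S μ = fun x => (weight n w l s)⁻¹ *
        ((Complex.I * m)⁻¹ * longitudinal (creS fun k => annC k (scale Φ.1)) n w l s S μ x -
          ((m : ℂ) ^ 2)⁻¹ * longitudinal (creB fun k => annL k (scale Φ.1)) n w l s S μ x) := by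
      funext x
      simp only [longitudinal, homotopyFamily_apply, Finset.mul_sum, ← Finset.sum_sub_distrib]
      exact Finset.sum_congr rfl fun ν _ => by ring
    have e' : longitudinal (homotopyBorel m Φ).1 n w l s S μ =
      longitudinal (homotopyFamily Φ.1) n w l s S μ := rfl
    rw [e', e]
    exact (((memLp_longitudinal_creS_annC h4 n w l s S μ).const_mul _).sub
      ((memLp_longitudinal_creB_annL hm h4 n w l s S μ).const_mul _)).const_mul _

theorem numberBorel_mem_finiteFamilies (hm : m ≠ 0) {Φ : borel m} (hΦ : Φ ∈ finiteFamilies m) :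
    numberBorel m Φ ∈ finiteFamilies m := by
  obtain ⟨h1, ⟨N, hN⟩, h3⟩ := mem_finiteFamilies_iff.1 hΦ
  refine mem_finiteFamilies_iff.2 ⟨h1.numberFamily, ⟨N, fun n w l s h => ?_⟩,
    fun n w l s S μ => ?_⟩
  · funext μ x
    have : numberFamily Φ.1 n w l s μ x = 0 := by
      simp [numberFamily, longitudinal, hN n w l s h]
    exact this
  · have e : longitudinal (numberBorel m Φ).1 n w l s S μ = fun x =>
        ((w + l + s : ℕ) : ℂ) * longitudinal Φ.1 n w l s S μ x +
          ∑ i, longitudinal Φ.1 n w l s (S ∪ {i}) μ x :=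
      funext fun x => longitudinal_numberFamily hm Φ.1 n w l s S μ x
    rw [e]
    exact ((h3 n w l s S μ).const_mul _).add (memLp_finsetSum _ fun i _ => h3 n w l s _ μ)

/-! ### Sums of commuting idempotents -/

section Idempotents

variable {ι V : Type*} [DecidableEq ι] [AddCommGroup V] [Module ℂ V]

/-- Applying `p a` replaces c by c + 1 and drops a from the sum, so `p a v = 0` by induction; then a
drops out of the original equation too. -/
theorem eq_zero_of_add_sum_idempotent {p : ι → Module.End ℂ V} (hp : ∀ i, p i * p i = p i)
    (hc : ∀ i j, Commute (p i) (p j)) (T : Finset ι) :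
    ∀ (c : ℕ), c ≠ 0 → ∀ v : V, (c : ℂ) • v + ∑ i ∈ T, p i v = 0 → v = 0 := by
  induction T using Finset.induction_on with
  | empty =>
    intro c hc0 v h
    rw [Finset.sum_empty, add_zero] at h
    exact (smul_eq_zero.1 h).resolve_left (Nat.cast_ne_zero.2 hc0)
  | insert a T ha ih =>
    intro c hc0 v h
    rw [Finset.sum_insert ha] at h
    have hv : p a v = 0 := by
      refine ih (c + 1) c.succ_ne_zero _ ?_
      have h' := congrArg (p a) h
      have e (i : ι) : p a (p i v) = p i (p a v) := LinearMap.congr_fun (hc a i).eq v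
      have e' : p a (p a v) = p a v := LinearMap.congr_fun (hp a) v
      simp only [map_add, map_smul, map_sum, map_zero, e'] at h'
      simp only [e] at h'
      push_cast
      rw [add_smul, one_smul, add_assoc]
      exact h'
    rw [hv, zero_add] at h
    exact ih c hc0 v h

/-- Applying `p a` to the relation gives the equation of the previous lemma for `p a v` with c = 1.
-/
theorem apply_eq_zero_of_sum_idempotent [Fintype ι] {p : ι → Module.End ℂ V}
    (hp : ∀ i, p i * p i = p i) (hc : ∀ i j, Commute (p i) (p j)) {v : V}
    (h : ∑ i, p i v = 0) (a : ι) : p a v = 0 := by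
  refine eq_zero_of_add_sum_idempotent hp hc (Finset.univ.erase a) 1 one_ne_zero _ ?_
  have h' := congrArg (p a) h
  have e (i : ι) : p a (p i v) = p i (p a v) := LinearMap.congr_fun (hc a i).eq v
  have e' : p a (p a v) = p a v := LinearMap.congr_fun (hp a) v
  rw [← Finset.add_sum_erase _ _ (Finset.mem_univ a), map_add, map_sum, map_zero, e'] at h'
  simp only [e] at h'
  simpa using h'

theorem aeval_mul_of_mul_eq {A : Type*} [Ring A] [Algebra ℂ A] {x y a : A} (h : x * a = y * a)
    (hc : Commute y a) (q : Polynomial ℂ) :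
    Polynomial.aeval x q * a = Polynomial.aeval y q * a := by
  induction q using Polynomial.induction_on' with
  | add p q hp hq => simp only [map_add, add_mul, hp, hq]
  | monomial n c =>
    have : x ^ n * a = y ^ n * a := by
      induction n with
      | zero => simp
      | succ n ih => rw [pow_succ, mul_assoc, h, hc.eq, ← mul_assoc, ih, mul_assoc, ← hc.eq,
          ← mul_assoc, ← pow_succ]
    simp only [Polynomial.aeval_monomial, mul_assoc, this]

/-- Split 1 = p a + (1 - p a). On the range of the first summand the operator is c + 1 plus the
smaller sum, on that of the second it is c plus the smaller sum. The eigenvalues are thus integers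
between c and c + |T|. -/
theorem aeval_add_sum_idempotent {p : ι → Module.End ℂ V} (hp : ∀ i, p i * p i = p i)
    (hc : ∀ i j, Commute (p i) (p j)) (T : Finset ι) :
    ∀ c M : ℕ, c + T.card ≤ M →
      Polynomial.aeval ((c : Module.End ℂ V) + ∑ i ∈ T, p i)
        (∏ j ∈ Finset.range (M + 1), (Polynomial.X - Polynomial.C (j : ℂ))) = 0 := by
  induction T using Finset.induction_on with
  | empty =>
    intro c M h
    simp only [Finset.card_empty, add_zero] at h
    obtain ⟨q, hq⟩ := Finset.dvd_prod_of_mem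
      (fun j : ℕ => (Polynomial.X - Polynomial.C (j : ℂ) : Polynomial ℂ))
      (Finset.mem_range.2 (Nat.lt_succ_of_le h))
    rw [hq, map_mul]
    simp
  | insert a T ha ih =>
    intro c M h
    rw [Finset.card_insert_of_notMem ha] at h
    set q : Polynomial ℂ := ∏ j ∈ Finset.range (M + 1), (Polynomial.X - Polynomial.C (j : ℂ))
    have hT : Commute (∑ i ∈ T, p i) (p a) := Commute.sum_left _ _ _ fun i _ => hc i a
    rw [Finset.sum_insert ha]
    have h1 : Polynomial.aeval ((c : Module.End ℂ V) + (p a + ∑ i ∈ T, p i)) q * p a = 0 := by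
      rw [aeval_mul_of_mul_eq (y := ((c + 1 : ℕ) : Module.End ℂ V) + ∑ i ∈ T, p i),
        ih (c + 1) M (by omega), zero_mul]
      · push_cast
        simp only [add_mul, hp, one_mul]
        abel
      · exact (Nat.cast_commute _ _).add_left hT
    have h2 : Polynomial.aeval ((c : Module.End ℂ V) + (p a + ∑ i ∈ T, p i)) q * (1 - p a) = 0 := by
      rw [aeval_mul_of_mul_eq (y := (c : Module.End ℂ V) + ∑ i ∈ T, p i),
        ih c M (by omega), zero_mul]
      · simp only [add_mul, mul_sub, mul_one, hp]
        abel
      · exact (Commute.one_right _).sub_right ((Nat.cast_commute _ _).add_left hT)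
    have h3 := congrArg₂ (· + ·) h1 h2
    simpa [← mul_add] using h3

theorem map_aeval_apply {W : Type*} [AddCommGroup W] [Module ℂ W] {f : V →ₗ[ℂ] W}
    {N : Module.End ℂ V} {M : Module.End ℂ W} (h : ∀ v, f (N v) = M (f v)) (q : Polynomial ℂ)
    (v : V) : f (Polynomial.aeval N q v) = Polynomial.aeval M q (f v) := by
  induction q using Polynomial.induction_on' with
  | add p q hp hq => simp only [map_add, LinearMap.add_apply, hp, hq]
  | monomial n c =>
    have : ∀ v, f ((N ^ n) v) = (M ^ n) (f v) := by
      induction n with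
      | zero => simp
      | succ n ih => intro v; simp only [pow_succ, Module.End.mul_apply, ih, h]
    simp [Polynomial.aeval_monomial, this]

theorem aeval_apply_mem {N : Module.End ℂ V} {U : Submodule ℂ V} (h : ∀ v ∈ U, N v ∈ U)
    (q : Polynomial ℂ) {v : V} (hv : v ∈ U) : Polynomial.aeval N q v ∈ U := by
  induction q using Polynomial.induction_on' with
  | add p q hp hq => simpa only [map_add, LinearMap.add_apply] using U.add_mem hp hq
  | monomial n c =>
    have : (N ^ n) v ∈ U := by
      induction n with
      | zero => simpa
      | succ n ih => rw [pow_succ', Module.End.mul_apply]; exact h _ ih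
    simpa [Polynomial.aeval_monomial] using U.smul_mem c this

end Idempotents

/-! ### Components of embedded Bosonic states -/

theorem embedFamily_of_ne {φ : boseBorel m} {n w l s : ℕ} (h : w + l + s ≠ 0)
    (μ : Fin n → Fin 4) (x : Conf m n w l s) : (embedFamily m φ).1 n w l s μ x = 0 := if_neg h

theorem embedFamily_of_eq {φ : boseBorel m} {n w l s : ℕ} (h : w + l + s = 0)
    (μ : Fin n → Fin 4) (x : Conf m n w l s) : (embedFamily m φ).1 n w l s μ x = φ.1 n μ x.1 :=
  if_pos h

/-! ### Spectrum and kernel of the number operator -/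

theorem longOp_idem (hm : m ≠ 0) {n : ℕ} (K : Fin n → Shell m) (i : Fin n) :
    longOp K {i} * longOp K {i} = longOp K {i} := by
  rw [longOp_mul hm, Finset.union_self]

theorem longOp_commute (hm : m ≠ 0) {n : ℕ} (K : Fin n → Shell m) (i j : Fin n) :
    Commute (longOp K {i}) (longOp K {j}) := by
  rw [Commute, SemiconjBy, longOp_mul hm, longOp_mul hm, Finset.union_comm]

/-- The tensor of values of a family at a configuration. -/
def tensorAt (m : ℝ) (n w l s : ℕ) (x : Conf m n w l s) :
    borel m →ₗ[ℂ] (Fin n → Fin 4) → ℂ where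
  toFun Φ := fun μ => Φ.1 n w l s μ x
  map_add' _ _ := rfl
  map_smul' _ _ := rfl

theorem tensorAt_numberBorel (n w l s : ℕ) (x : Conf m n w l s) (Φ : borel m) :
    tensorAt m n w l s x (numberBorel m Φ) =
      (((w + l + s : ℕ) : Module.End ℂ ((Fin n → Fin 4) → ℂ)) + ∑ i, longOp x.1 {i})
        (tensorAt m n w l s x Φ) := by
  funext μ
  have h : (((w + l + s : ℕ) : Module.End ℂ ((Fin n → Fin 4) → ℂ)) (tensorAt m n w l s x Φ)) =
      ((w + l + s : ℕ) : ℂ) • tensorAt m n w l s x Φ := by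
    rw [Module.End.natCast_apply, Nat.cast_smul_eq_nsmul]
  rw [LinearMap.add_apply, h, LinearMap.sum_apply, Pi.add_apply, Finset.sum_apply]
  rfl

theorem exists_aeval_number_eq_zero (hm : m ≠ 0) {Φ : borel m} (hΦ : Φ ∈ finiteFamilies m) :
    ∃ q : Polynomial ℂ, q.eval 0 ≠ 0 ∧
      Polynomial.aeval (number m) (q * Polynomial.X) ((null m).mkQ Φ) = 0 := by
  obtain ⟨-, ⟨N, hN⟩, -⟩ := hΦ
  -- The roots are 1, …, N; the missing root 0 is supplied by the factor X.
  refine ⟨∏ j ∈ Finset.range N, (Polynomial.X - Polynomial.C ((j + 1 : ℕ) : ℂ)), ?_, ?_⟩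
  · rw [Polynomial.eval_prod, Finset.prod_ne_zero_iff]
    intro j _
    simp only [Polynomial.eval_sub, Polynomial.eval_X, Polynomial.eval_C, zero_sub]
    exact neg_ne_zero.2 (Nat.cast_ne_zero.2 j.succ_ne_zero)
  · have e : (∏ j ∈ Finset.range N, (Polynomial.X - Polynomial.C ((j + 1 : ℕ) : ℂ))) *
        Polynomial.X = ∏ j ∈ Finset.range (N + 1), (Polynomial.X - Polynomial.C (j : ℂ)) := by
      rw [Finset.prod_range_succ']
      simp
    rw [e, ← map_aeval_apply (f := (null m).mkQ) (N := numberBorel m) (fun _ => rfl)]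
    refine (congrArg _ (Subtype.ext ?_)).trans ((null m).mkQ.map_zero)
    funext n w l s μ x
    have h := map_aeval_apply (f := tensorAt m n w l s x) (tensorAt_numberBorel n w l s x)
      (∏ j ∈ Finset.range (N + 1), (Polynomial.X - Polynomial.C (j : ℂ))) Φ
    have h0 : tensorAt m n w l s x (Polynomial.aeval (numberBorel m)
        (∏ j ∈ Finset.range (N + 1), (Polynomial.X - Polynomial.C (j : ℂ))) Φ) = 0 := by
      rw [h]
      rcases le_or_gt (n + w + l + s) N with hle | hgt
      · rw [aeval_add_sum_idempotent (longOp_idem hm x.1) (longOp_commute hm x.1) _ _ _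
          (by simp; omega), LinearMap.zero_apply]
      · have : tensorAt m n w l s x Φ = 0 := by
          funext μ
          simp [tensorAt, hN n w l s hgt]
        rw [this, map_zero]
    exact congrFun h0 μ

theorem measurePreserving_fst_noGhosts (m : ℝ) (n : ℕ) :
    MeasurePreserving (Prod.fst : Conf m n 0 0 0 → _) (confMeasure m n 0 0 0)
      (prodMeasure m n) := by
  have h0 : IsProbabilityMeasure (prodMeasure m 0) := by
    unfold prodMeasure
    rw [Measure.pi_of_empty]
    infer_instance
  exact measurePreserving_fst

/-- If w + l + s > 0, N is positive on the component, which therefore vanishes. Otherwise each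
longitudinal projection vanishes, and as k₀ ≠ 0 the component of index 0 yields transversality. -/
theorem mkQ_mem_physical_of_number_eq_zero (hm : 0 < m) {Φ : borel m} (hΦ : Φ ∈ finiteFamilies m)
    (h : number m ((null m).mkQ Φ) = 0) : (null m).mkQ Φ ∈ (physical m).map (embed m) := by
  have hN : numberBorel m Φ ∈ null m := (Submodule.Quotient.mk_eq_zero _).1 h
  have hae (n w l s : ℕ) : ∀ᵐ x ∂confMeasure m n w l s,
      ((w + l + s : ℕ) : ℂ) • tensorAt m n w l s x Φ +
        ∑ i, longOp x.1 {i} (tensorAt m n w l s x Φ) = 0 := by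
    filter_upwards [ae_all_iff.2 fun μ => hN n w l s μ] with x hx
    funext μ
    rw [Pi.add_apply, Finset.sum_apply]
    exact hx μ
  have hghost (n w l s : ℕ) (h0 : w + l + s ≠ 0) (μ : Fin n → Fin 4) :
      Φ.1 n w l s μ =ᵐ[confMeasure m n w l s] 0 := by
    filter_upwards [hae n w l s] with x hx
    exact congrFun (eq_zero_of_add_sum_idempotent (longOp_idem hm.ne' x.1)
      (longOp_commute hm.ne' x.1) _ _ h0 _ hx) μ
  have hlong (n : ℕ) (μ : Fin (n + 1) → Fin 4) :
      longitudinal Φ.1 (n + 1) 0 0 0 {0} μ =ᵐ[confMeasure m (n + 1) 0 0 0] 0 := by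
    filter_upwards [hae (n + 1) 0 0 0] with x hx
    simp only [add_zero, Nat.cast_zero, zero_smul, zero_add] at hx
    exact congrFun (apply_eq_zero_of_sum_idempotent (longOp_idem hm.ne' x.1)
      (longOp_commute hm.ne' x.1) hx 0) μ
  -- The ghost variables range over a one-point space, so `default` is the only choice.
  let φ : boseBorel m := ⟨fun n μ K => Φ.1 n 0 0 0 μ (K, default, default, default),
    fun n μ => (Φ.2 n 0 0 0 μ).comp (by fun_prop)⟩
  have hφ (n : ℕ) (μ : Fin n → Fin 4) (x : Conf m n 0 0 0) :
      φ.1 n μ x.1 = Φ.1 n 0 0 0 μ x :=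
    congrArg (Φ.1 n 0 0 0 μ) (Prod.ext rfl (Subsingleton.elim _ _))
  refine ⟨(boseNull m).mkQ φ, ⟨φ, ⟨⟨fun n π μ K => ?_, ?_⟩, fun n μ => ?_⟩, rfl⟩, ?_⟩
  · have h1 := hΦ.1.1 n 0 0 0 π 1 1 1 μ (K, default, default, default)
    simpa using h1
  · refine lt_of_le_of_lt ?_ hΦ.1.2
    rw [← normSq_embedFamily]
    unfold normSq
    refine ENNReal.tsum_le_tsum fun n => ENNReal.tsum_le_tsum fun w => ENNReal.tsum_le_tsum
      fun l => ENNReal.tsum_le_tsum fun s => Finset.sum_le_sum fun μ _ => lintegral_mono fun x => ?_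
    by_cases h0 : w + l + s = 0
    · obtain ⟨rfl, rfl, rfl⟩ : w = 0 ∧ l = 0 ∧ s = 0 := by omega
      simp only [embedFamily, LinearMap.coe_mk, AddHom.coe_mk, h0, if_true, hφ]
      exact le_rfl
    · simp [embedFamily_of_ne h0]
  · have h1 : ∀ᵐ x ∂confMeasure m (n + 1) 0 0 0,
        ∑ ν : Fin 4, upper (x.1 0) ν * φ.1 (n + 1) (Matrix.vecCons ν μ) x.1 = 0 := by
      filter_upwards [hlong n (Matrix.vecCons 0 μ)] with x hx
      have h2 : longitudinal Φ.1 (n + 1) 0 0 0 {0} (Matrix.vecCons 0 μ) x =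
          lower (x.1 0) 0 / (m : ℂ) ^ 2 *
            ∑ ν : Fin 4, upper (x.1 0) ν * φ.1 (n + 1) (Matrix.vecCons ν μ) x.1 := by
        rw [longitudinal_singleton, Finset.mul_sum]
        refine Finset.sum_congr rfl fun ν _ => ?_
        have : Function.update (Matrix.vecCons (0 : Fin 4) μ) 0 ν = Matrix.vecCons ν μ :=
          Fin.update_cons_zero (α := fun _ => Fin 4) 0 μ ν
        rw [this, hφ]
        simp only [Matrix.cons_val_zero]
        ring
      have h3 : lower (x.1 0) 0 / (m : ℂ) ^ 2 ≠ 0 := by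
        refine div_ne_zero ?_ (pow_ne_zero 2 (by exact_mod_cast hm.ne'))
        simpa [lower, upper] using (x.1 0).2.2.ne'
      exact (mul_eq_zero.1 (h2.symm.trans hx)).resolve_left h3
    rw [← (measurePreserving_fst_noGhosts m (n + 1)).map_eq,
      ae_map_iff measurable_fst.aemeasurable]
    · exact h1
    · refine measurableSet_eq_fun (Finset.measurable_fun_sum _ fun ν _ => ?_) measurable_const
      exact Measurable.mul ((measurable_upper ν).comp (measurable_pi_apply 0))
        (φ.2 (n + 1) (Matrix.vecCons ν μ))
  · refine (Submodule.Quotient.eq (null m)).2 fun n w l s μ => ?_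
    by_cases h0 : w + l + s = 0
    · obtain ⟨rfl, rfl, rfl⟩ : w = 0 ∧ l = 0 ∧ s = 0 := by omega
      filter_upwards with x
      have : φ.1 n μ x.1 - Φ.1 n 0 0 0 μ x = 0 := by rw [hφ, sub_self]
      exact this
    · filter_upwards [hghost n w l s h0 μ] with x hx
      have : (embedFamily m φ).1 n w l s μ x - Φ.1 n w l s μ x = 0 := by
        rw [hx, embedFamily_of_ne h0, Pi.zero_apply, sub_zero]
      exact this

/-! ### Transversal states without ghosts -/

theorem embedFamily_transversal {φ : boseBorel m} (hφ : φ ∈ transversalFamilies m)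
    (n w l s : ℕ) (μ : Fin n → Fin 4) : ∀ᵐ x ∂confMeasure m (n + 1) w l s,
      ∑ ν, upper (x.1 0) ν * (embedFamily m φ).1 (n + 1) w l s (Matrix.vecCons ν μ) x = 0 := by
  by_cases h : w + l + s = 0
  · filter_upwards [Measure.quasiMeasurePreserving_fst (μ := prodMeasure m (n + 1))
      (ν := (prodMeasure m w).prod ((prodMeasure m l).prod (prodMeasure m s))) |>.ae
        (hφ n μ)] with x hx
    simpa only [embedFamily_of_eq h] using hx
  · filter_upwards with x
    simp [embedFamily_of_ne h]

/-- Only the term contracting k^ν with a vector Boson has a ghost-free source, and transversality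
kills it. No bound on the particle number is needed. -/
theorem charge_embed {φ : BoseWave m} (hφ : φ ∈ physical m) : charge m (embed m φ) = 0 := by
  obtain ⟨φ, ⟨-, h⟩, rfl⟩ := hφ
  refine (Submodule.Quotient.mk_eq_zero (null m)).2 fun n w l s μ => ?_
  have h1 : chargeVectorC (embedFamily m φ).1 n w l s μ =ᵐ[confMeasure m n w l s] 0 := by
    rcases l with _ | l
    · exact Filter.EventuallyEq.rfl
    · have : ∀ i : Fin (l + 1), _ := fun i =>
        (measurePreserving_vectorC m n w l s i).quasiMeasurePreserving.ae
          (embedFamily_transversal h n w l s μ)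
      filter_upwards [ae_all_iff.2 this] with x hx
      simp only [Matrix.cons_val_zero] at hx
      simp [chargeVectorC, hx]
  filter_upwards [h1] with x e1
  have e2 : chargeVectorB (embedFamily m φ).1 n w l s μ x = 0 := by
    rcases n with _ | n <;> simp [chargeVectorB, embedFamily]
  have e3 : chargeScalarC (embedFamily m φ).1 n w l s μ x = 0 := by
    rcases l with _ | l <;> simp [chargeScalarC, embedFamily]
  have e4 : chargeScalarB (embedFamily m φ).1 n w l s μ x = 0 := by
    rcases s with _ | s <;> simp [chargeScalarB, embedFamily]
  have : chargeFamily (embedFamily m φ).1 n w l s μ x = 0 := by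
    simp only [chargeFamily, Pi.add_apply, e1, e2, e3, e4, Pi.zero_apply, add_zero]
  exact this

theorem homotopy_embed {φ : BoseWave m} (hφ : φ ∈ physical m) : homotopy m (embed m φ) = 0 := by
  obtain ⟨φ, ⟨-, h⟩, rfl⟩ := hφ
  refine (Submodule.Quotient.mk_eq_zero (null m)).2 fun n w l s μ =>
    homotopyFamily_ae_eq_zero (fun r _ => ?_) fun r _ => embedFamily_transversal h n r l s μ
  filter_upwards with x
  simp [embedFamily]

theorem embed_injective (m : ℝ) : Function.Injective (embed m) := by
  rw [injective_iff_map_eq_zero]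
  intro φ h
  obtain ⟨φ, rfl⟩ := (boseNull m).mkQ_surjective φ
  have h' : embedFamily m φ ∈ null m := (Submodule.Quotient.mk_eq_zero _).1 h
  refine (Submodule.Quotient.mk_eq_zero (boseNull m)).2 fun n μ => ?_
  rw [Filter.EventuallyEq, ← (measurePreserving_fst_noGhosts m n).map_eq,
    ae_map_iff measurable_fst.aemeasurable (measurableSet_eq_fun (φ.2 n μ) measurable_zero)]
  exact h' n 0 0 0 μ

theorem charge_homotopy_add (hm : m ≠ 0) {Φ : borel m} (hΦ : IsSymm Φ.1) :
    charge m (homotopy m ((null m).mkQ Φ)) + homotopy m (charge m ((null m).mkQ Φ)) =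
      number m ((null m).mkQ Φ) :=
  congrArg (null m).mkQ (Subtype.ext (chargeFamily_homotopyFamily_add hm hΦ) :
    chargeBorel m (homotopyBorel m Φ) + homotopyBorel m (chargeBorel m Φ) = numberBorel m Φ)

theorem charge_charge {Φ : borel m} (hΦ : IsSymm Φ.1) :
    charge m (charge m ((null m).mkQ Φ)) = 0 :=
  congrArg (null m).mkQ (Subtype.ext (chargeFamily_chargeFamily hΦ) :
    chargeBorel m (chargeBorel m Φ) = 0)

/-! ### Homology of an operator with a contracting homotopy -/

section Homology

variable {V : Type*} [AddCommGroup V] [Module ℂ V]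

/-- If `QH + HQ = N` on `D`, and `N` has a semisimple eigenvalue zero there with eigenspace in `P`,
then every closed `x ∈ D` differs from an element of `P` by the boundary of an element of `D`. -/
theorem exists_sub_mem_of_homotopy {Q H N : Module.End ℂ V} {D P : Submodule ℂ V}
    (hH : ∀ x ∈ D, H x ∈ D) (hN : ∀ x ∈ D, N x ∈ D) (hQ : ∀ x ∈ D, Q (Q x) = 0)
    (hQH : ∀ x ∈ D, Q (H x) + H (Q x) = N x) (hker : ∀ x ∈ D, N x = 0 → x ∈ P)
    (hq : ∀ x ∈ D, ∃ q : Polynomial ℂ, q.eval 0 ≠ 0 ∧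
      Polynomial.aeval N (q * Polynomial.X) x = 0) {x : V} (hx : x ∈ D) (hQx : Q x = 0) :
    ∃ y ∈ D, Q y ∈ D ∧ x - Q y ∈ P := by
  obtain ⟨q, hq0, hqx⟩ := hq x hx
  have hq0' : q.coeff 0 ≠ 0 := by rwa [Polynomial.coeff_zero_eq_eval_zero]
  set U : Submodule ℂ V := D ⊓ LinearMap.ker Q
  have hU : ∀ v ∈ U, N v ∈ U := fun v hv => by
    have hv2 : Q v = 0 := hv.2
    refine ⟨hN v hv.1, ?_⟩
    rw [SetLike.mem_coe, LinearMap.mem_ker, ← hQH v hv.1, hv2, map_zero, add_zero, hQ _ (hH v hv.1)]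
  -- Writing q = X · `q.divX` + q(0), this choice gives x - Nz = q(N)x / q(0), which N annihilates.
  -- As z is closed, Nz = Q(Hz).
  obtain ⟨z, hz⟩ : ∃ z, z = -(q.coeff 0)⁻¹ • Polynomial.aeval N q.divX x := ⟨_, rfl⟩
  have hzU : z ∈ U := hz ▸ U.smul_mem _ (aeval_apply_mem hU _ ⟨hx, hQx⟩)
  have hz2 : Q z = 0 := hzU.2
  have e : Q (H z) = N z := by rw [← hQH z hzU.1, hz2, map_zero, add_zero]
  have e' : x - N z = (q.coeff 0)⁻¹ • Polynomial.aeval N q x := by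
    have h := congrArg (fun p => Polynomial.aeval N p x) q.X_mul_divX_add
    simp only [map_add, map_mul, Polynomial.aeval_X, Polynomial.aeval_C, LinearMap.add_apply,
      Module.End.mul_apply, Module.algebraMap_end_apply] at h
    rw [← h, hz, map_smul, smul_add, smul_smul, inv_mul_cancel₀ hq0', one_smul]
    module
  refine ⟨H z, hH z hzU.1, e ▸ hN z hzU.1, hker _ ?_ ?_⟩
  · rw [e]
    exact D.sub_mem hx (hN z hzU.1)
  · rw [e, e', map_smul, ← Module.End.mul_apply]
    have : N * Polynomial.aeval N q = Polynomial.aeval N (q * Polynomial.X) := by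
      rw [mul_comm q, map_mul, Polynomial.aeval_X]
    rw [this, hqx, smul_zero]

/-- In the situation of `exists_sub_mem_of_homotopy`, a boundary of an element of `D` on which `QH`
vanishes is zero. -/
theorem eq_zero_of_homotopy {Q H N : Module.End ℂ V} {D P : Submodule ℂ V}
    (hH : ∀ x ∈ D, H x ∈ D) (hN : ∀ x ∈ D, N x ∈ D) (hQ : ∀ x ∈ D, Q (Q x) = 0)
    (hQH : ∀ x ∈ D, Q (H x) + H (Q x) = N x) (hker : ∀ x ∈ D, N x = 0 → x ∈ P)
    (hP : ∀ x ∈ P, Q x = 0)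
    (hq : ∀ x ∈ D, ∃ q : Polynomial ℂ, q.eval 0 ≠ 0 ∧
      Polynomial.aeval N (q * Polynomial.X) x = 0) {x : V} (hx : x ∈ D) (hQx : Q (H (Q x)) = 0) :
    Q x = 0 := by
  obtain ⟨q, hq0, hqx⟩ := hq x hx
  have hq0' : q.coeff 0 ≠ 0 := by rwa [Polynomial.coeff_zero_eq_eval_zero]
  -- By Q² = 0 on D, applied to Hv. Only the vector v and its image Hv have to lie in D, not Qv.
  have hQN : ∀ v ∈ D, Q (N v) = Q (H (Q v)) := fun v hv => by
    rw [← hQH v hv, map_add, hQ _ (hH v hv), zero_add]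
  set U : Submodule ℂ V := D ⊓ LinearMap.ker (Q * H * Q)
  have hU : ∀ v ∈ U, N v ∈ U := fun v hv => by
    have hv2 : Q (H (Q v)) = 0 := hv.2
    refine ⟨hN v hv.1, ?_⟩
    rw [SetLike.mem_coe, LinearMap.mem_ker, Module.End.mul_apply, Module.End.mul_apply,
      hQN v hv.1, hv2, map_zero, map_zero]
  have hz := aeval_apply_mem hU q.divX (v := x) ⟨hx, hQx⟩
  have hz2 : Q (H (Q (Polynomial.aeval N q.divX x))) = 0 := hz.2
  -- q(N)x lies in ker N, hence in P, where Q vanishes. Expanding q as above, the X-part contributes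
  -- QHQ of an element of U, which is 0, and leaves q(0) Qx = 0.
  have h0 : Q (Polynomial.aeval N q x) = 0 := by
    refine hP _ (hker _ (aeval_apply_mem hN q hx) ?_)
    rw [← hqx, mul_comm, map_mul, Polynomial.aeval_X, Module.End.mul_apply]
  have h := congrArg (fun p => Polynomial.aeval N p x) q.X_mul_divX_add
  simp only [map_add, map_mul, Polynomial.aeval_X, Polynomial.aeval_C, LinearMap.add_apply,
    Module.End.mul_apply, Module.algebraMap_end_apply] at h
  rw [← h, map_add, hQN _ hz.1, hz2, zero_add, map_smul] at h0
  exact (smul_eq_zero.1 h0).resolve_left hq0'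

end Homology

/-! ### Homology of the supercharge -/

theorem charge_charge_of_mem_admissible {Φ : Wave m} (hΦ : Φ ∈ admissible m) :
    charge m (charge m Φ) = 0 := by
  obtain ⟨_, ⟨φ, hφ, rfl⟩, _, ⟨Ψ, hΨ, rfl⟩, rfl⟩ := Submodule.mem_sup.1 hΦ
  rw [map_add, map_add, charge_embed hφ, map_zero, zero_add, charge_charge hΨ.1.1]

theorem imCharge_le_kerCharge (m : ℝ) : imCharge m ≤ kerCharge m := by
  rintro _ ⟨Φ, hΦ, rfl⟩
  have h := charge_charge_of_mem_admissible hΦ.1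
  refine ⟨⟨hΦ.2, ?_⟩, h⟩
  rw [SetLike.mem_coe, Submodule.mem_comap, h]
  exact Submodule.zero_mem _

theorem embed_mem_kerCharge {φ : BoseWave m} (hφ : φ ∈ physical m) :
    embed m φ ∈ kerCharge m := by
  have h := charge_embed hφ
  refine ⟨⟨Submodule.mem_sup_left ⟨φ, hφ, rfl⟩, ?_⟩, h⟩
  rw [SetLike.mem_coe, Submodule.mem_comap, h]
  exact Submodule.zero_mem _

theorem homotopy_mem_finite (hm : 0 < m) :
    ∀ x ∈ (finiteFamilies m).map (null m).mkQ,
      homotopy m x ∈ (finiteFamilies m).map (null m).mkQ := by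
  rintro _ ⟨Φ, hΦ, rfl⟩
  exact ⟨_, homotopyBorel_mem_finiteFamilies hm hΦ, rfl⟩

theorem number_mem_finite (hm : m ≠ 0) :
    ∀ x ∈ (finiteFamilies m).map (null m).mkQ,
      number m x ∈ (finiteFamilies m).map (null m).mkQ := by
  rintro _ ⟨Φ, hΦ, rfl⟩
  exact ⟨_, numberBorel_mem_finiteFamilies hm hΦ, rfl⟩

theorem exists_embed_sub_mem_imCharge (hm : 0 < m) {Φ : Wave m} (hΦ : Φ ∈ kerCharge m) :
    ∃ φ ∈ physical m, embed m φ - Φ ∈ imCharge m := by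
  obtain ⟨⟨hD, -⟩, hQ⟩ := hΦ
  obtain ⟨_, ⟨φ, hφ, rfl⟩, Ψ, hΨ, rfl⟩ := Submodule.mem_sup.1 hD
  have hQΨ : charge m Ψ = 0 := by
    rw [SetLike.mem_coe, LinearMap.mem_ker, map_add, charge_embed hφ, zero_add] at hQ
    exact hQ
  obtain ⟨y, hy, hQy, φ', hφ', h⟩ := exists_sub_mem_of_homotopy
    (P := (physical m).map (embed m)) (homotopy_mem_finite hm) (number_mem_finite hm.ne')
    (fun x hx => charge_charge_of_mem_admissible (Submodule.mem_sup_right hx))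
    (by rintro _ ⟨Φ, hΦ, rfl⟩; exact charge_homotopy_add hm.ne' hΦ.1.1)
    (by rintro _ ⟨Φ, hΦ, rfl⟩ h; exact mkQ_mem_physical_of_number_eq_zero hm hΦ h)
    (by rintro _ ⟨Φ, hΦ, rfl⟩; exact exists_aeval_number_eq_zero hm.ne' hΦ) hΨ hQΨ
  -- The sign of y matches the order of the difference; y is in the domain of Q because both y and
  -- Qy are in 𝓓₀.
  refine ⟨φ + φ', Submodule.add_mem _ hφ hφ', -y,
    Submodule.neg_mem _ ⟨Submodule.mem_sup_right hy, Submodule.mem_sup_right hQy⟩, ?_⟩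
  rw [map_neg, map_add, h]
  abel

/-- The component of the preimage in ι(𝓗') is closed and may be discarded. The rest Ψ is in 𝓓₀ and
has QΨ = ιφ, so HQΨ = 0 because H kills ι(𝓗'). The abstract lemma then gives QΨ = 0. -/
theorem eq_zero_of_embed_mem_imCharge (hm : 0 < m) {φ : BoseWave m} (hφ : φ ∈ physical m)
    (h : embed m φ ∈ imCharge m) : φ = 0 := by
  obtain ⟨Φ, ⟨hD, -⟩, hQ⟩ := h
  obtain ⟨_, ⟨ψ, hψ, rfl⟩, Ψ, hΨ, rfl⟩ := Submodule.mem_sup.1 hD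
  rw [map_add, charge_embed hψ, zero_add] at hQ
  refine embed_injective m ?_
  rw [map_zero, ← hQ]
  refine eq_zero_of_homotopy (H := homotopy m) (N := number m)
    (P := (physical m).map (embed m)) (homotopy_mem_finite hm) (number_mem_finite hm.ne')
    (fun x hx => charge_charge_of_mem_admissible (Submodule.mem_sup_right hx))
    (by rintro _ ⟨Φ, hΦ, rfl⟩; exact charge_homotopy_add hm.ne' hΦ.1.1)
    (by rintro _ ⟨Φ, hΦ, rfl⟩ h; exact mkQ_mem_physical_of_number_eq_zero hm hΦ h)
    (by rintro _ ⟨φ, hφ, rfl⟩; exact charge_embed hφ)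
    (by rintro _ ⟨Φ, hΦ, rfl⟩; exact exists_aeval_number_eq_zero hm.ne' hΦ) hΨ ?_
  rw [hQ, homotopy_embed hφ, map_zero]

/-- The map that sends a transversal state to its homology class. -/
def homologyClass (m : ℝ) : physical m →ₗ[ℂ]
    kerCharge m ⧸ (imCharge m).submoduleOf (kerCharge m) :=
  ((imCharge m).submoduleOf (kerCharge m)).mkQ ∘ₗ
    ((embed m).restrict fun _ hΦ => embed_mem_kerCharge hΦ)

theorem homologyClass_bijective (hm : 0 < m) : Function.Bijective (homologyClass m) := by
  constructor
  · rw [injective_iff_map_eq_zero]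
    intro φ h
    exact Subtype.ext (eq_zero_of_embed_mem_imCharge hm φ.2
      ((Submodule.Quotient.mk_eq_zero ((imCharge m).submoduleOf (kerCharge m))).1 h))
  · intro y
    obtain ⟨Φ, rfl⟩ := Submodule.mkQ_surjective _ y
    obtain ⟨φ, hφ, h⟩ := exists_embed_sub_mem_imCharge hm Φ.2
    exact ⟨⟨φ, hφ⟩, (Submodule.Quotient.eq _).2 h⟩

end SpinOneBoson

end

theorem mainTheorem4 (m : ℝ) (hm : 0 < m) :
    SpinOneBoson.imCharge m ≤ SpinOneBoson.kerCharge m ∧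
    ∃ (hH : ∀ Φ ∈ SpinOneBoson.physical m, SpinOneBoson.embed m Φ ∈ SpinOneBoson.kerCharge m)
      (e : (SpinOneBoson.kerCharge m ⧸
          (SpinOneBoson.imCharge m).submoduleOf (SpinOneBoson.kerCharge m)) ≃ₗ[ℂ]
        SpinOneBoson.physical m),
      ∀ Φ : SpinOneBoson.physical m,
        e (Submodule.Quotient.mk ⟨SpinOneBoson.embed m Φ, hH Φ Φ.2⟩) = Φ :=
  ⟨SpinOneBoson.imCharge_le_kerCharge m, fun _ hΦ => SpinOneBoson.embed_mem_kerCharge hΦ,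
    (LinearEquiv.ofBijective _ (SpinOneBoson.homologyClass_bijective hm)).symm,
    fun Φ => LinearEquiv.symm_apply_apply
      (LinearEquiv.ofBijective _ (SpinOneBoson.homologyClass_bijective hm)) Φ⟩
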